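/- For $f,g:\{0,1\}^n\to\{0,1\}$ let $\mathrm{dist}(f,g)=\Pr_{x}[f(x)\ne g(x)]$ for uniformly random $x\in\{0,1\}^n$. Call $f$ monotone if $f(x)\le f(y)$ whenever $x\le y$ coordinatewise, and $\varepsilon$-far from monotone if $\mathrm{dist}(f,g)>\varepsilon$ for every monotone $g:\{0,1\}^n\to\{0,1\}$. A randomized non-adaptive $q$-query algorithm is a probability distribution over pairs consisting of $q$ query points in $\{0,1\}^n$ (fixed before any answer of the oracle $f$ is seen) and a rule that outputs Yes or No as a function of the $q$ answers. There is a one-sided, non-adaptive algorithm for testing whether an unknown $n$-variable Boolean function is monotone versus $\varepsilon$-far from monotone that makes $\tilde O(n^{5/6}\varepsilon^{-4})$ queries. That is, there are absolute constants $C,c$ and, for every $n\ge 0$ and every $\varepsilon>0$, a randomized non-adaptive algorithm $T_{n,\varepsilon}$ making $q(n,\varepsilon)\le C\,n^{5/6}\,\varepsilon^{-4}\,(\log(n+2))^{c}$ queries to $f:\{0,1\}^n\to\{0,1\}$ such that - if $f$ is monotone, then $T_{n,\varepsilon}$ outputs Yes with probability $1$; - if $f$ is $\varepsilon$-far from monotone,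 then $T_{n,\varepsilon}$ outputs No with probability at least $2/3$. -/

import Mathlib

open scoped ENNReal

namespace MonotonicityTesting

/-- The Boolean hypercube `{0,1}^n`. Its order is the coordinatewise one (`false ≤ true`). -/
abbrev Cube (n : ℕ) : Type := Fin n → Bool

/-- Normalized Hamming distance `Pr_x [f x ≠ g x]` for uniform `x` in the cube. -/
noncomputable def dist {n : ℕ} (f g : Cube n → Bool) : ℝ :=
  ((Finset.univ.filter fun x : Cube n => f x ≠ g x).card : ℝ) / 2 ^ n

/-- `f` is `ε`-close to monotone: `dist f g ≤ ε` for some monotone `g`. -/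
def CloseToMonotone {n : ℕ} (ε : ℝ) (f : Cube n → Bool) : Prop :=
  ∃ g : Cube n → Bool, Monotone g ∧ dist f g ≤ ε

/-- `f` is `ε`-far from monotone. -/
def FarFromMonotone {n : ℕ} (ε : ℝ) (f : Cube n → Bool) : Prop :=
  ¬ CloseToMonotone ε f

/-- A deterministic non-adaptive algorithm with `q` queries to an oracle `Cube n → Bool`: the query
points are fixed before any answer is seen, and the verdict (`true` for "Yes", `false` for "No")
is a function of the `q` answers. -/
structure DetNonadaptive (n q : ℕ) : Type where
  query : Fin q → Cube n
  verdict : (Fin q → Bool) → Bool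

/-- The output of a deterministic non-adaptive algorithm on the oracle `f`. -/
def DetNonadaptive.output {n q : ℕ} (A : DetNonadaptive n q) (f : Cube n → Bool) : Bool :=
  A.verdict fun i => f (A.query i)

/-- A randomized non-adaptive algorithm with `q` queries: a probability distribution over
deterministic ones. -/
abbrev RandNonadaptive (n q : ℕ) : Type := PMF (DetNonadaptive n q)

/-- The probability that the randomized algorithm `T` outputs `b` on the oracle `f`. -/
noncomputable def RandNonadaptive.prob {n q : ℕ} (T : RandNonadaptive n q)
    (f : Cube n → Bool) (b : Bool) : ℝ≥0∞ :=
  (PMF.map (fun A : DetNonadaptive n q => A.output f) T) b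

/-- `T` is a one-sided tester for monotonicity versus `ε`-far from monotone: it outputs "Yes" with
probability `1` on every monotone function, and "No" with probability at least `2/3` on every
function that is `ε`-far from monotone. -/
def IsOneSidedMonotonicityTester {n q : ℕ} (ε : ℝ) (T : RandNonadaptive n q) : Prop :=
  (∀ f : Cube n → Bool, Monotone f → T.prob f true = 1) ∧
    ∀ f : Cube n → Bool, FarFromMonotone ε f → 2 / 3 ≤ T.prob f false

end MonotonicityTesting

/-!
The tester draws independent pairs of comparable points, each the two ends of a random edge or of a
random short directed walk, and rejects if `f` decreases along one of them. That a function far from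
monotone is rejected rests on two facts.

*Directed isoperimetry* (`le_of_farFromMonotone`). Let `I` be the number of decreasing edges per
point and `μ` the density of a maximal matching of such edges. Then, up to logarithms and powers of
`ε`, the quantity `l * I + μ / l` is bounded below for every `l > 0`, so `I` and `μ` cannot both be
small. For fixed `x`, let `g S` be the value at `x` of `f` sorted in the directions in `S`. Sorting
does not increase the number of decreasing edges, and it carries a vertex cover of them, encoded by functions
`fm ≤ f ≤ fp`, to a vertex cover, because it is monotone and preserves averages. Hence the sensitive
edges of `g` are, on average over `x`, few and covered by few vertices, and an undirected inequality
(`expect_ne_compl_le`) shows that `g S` and `g Sᶜ` mostly agree. The undirected inequality adds the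
coordinates one at a time to the conditioning, each time the one that raises the conditional energy
least; the total increment over all directions is a degree-one Fourier weight, which is controlled
by the sensitive edges. Since sorting is a contraction and is idempotent, `f` sorted in a random
half of a set of directions is therefore close to `f` sorted in the whole set, provided that the
other half comes first. After logarithmically many halvings no direction is left
(`exists_random_order`), so `f` is close to a fully sorted, hence monotone, function.

*Random walks* (`le_expect_lower_upper`). Suppose that `I ≤ √n`. Then the total influence of `f` is
of order `√n` (`sum_influence_le`), and a walk that moves each coordinate with probability `p` of
order `μ / √n`, up to a logarithm, changes the value of `f` with probability at most a small multiple
of `μ` (`expect_ne_lower_le`). So most edges of the matching, when crossed by a walk, are crossed by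
one that starts where `f` is true and ends where `f` is false; a given edge is crossed with
probability `p`, and the walk succeeds with probability of order `p * μ`, that is `μ² / √n`.

With `l = n ^ (-1 / 6)` either `I` is at least of order `n ^ (1 / 6)` and a random edge succeeds with
probability `I / n`, or `μ` is at least of order `n ^ (-1 / 6)` and a random walk succeeds with
probability `μ² / √n`; both are of order `n ^ (-5 / 6)`.
-/

namespace MonotonicityTesting

open Finset
open scoped BigOperators

/-! ### Averages over product spaces -/

section Averages

variable {n : ℕ}

/-- The indicator of a Boolean, as a real number. -/
def ind (b : Bool) : ℝ := if b then 1 else 0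

/-- The point `x` with its `i`-th coordinate negated. -/
def flip (i : Fin n) (x : Cube n) : Cube n := Function.update x i (!x i)

/-- The Walsh character of degree one in direction `i`, with value `1` where `x i` holds and `-1`
elsewhere. -/
def sgn (i : Fin n) (x : Cube n) : ℝ := if x i then 1 else -1

lemma ind_nonneg (b : Bool) : 0 ≤ ind b := by cases b <;> simp [ind]

lemma ind_le_one (b : Bool) : ind b ≤ 1 := by cases b <;> simp [ind]

@[simp] lemma flip_flip (i : Fin n) (x : Cube n) : flip i (flip i x) = x := by
  ext j; by_cases h : j = i
  · subst h; simp [flip]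
  · simp [flip, h]

@[simp] lemma flip_apply_self (i : Fin n) (x : Cube n) : flip i x i = !x i := by simp [flip]

lemma flip_apply_of_ne {i j : Fin n} (h : j ≠ i) (x : Cube n) : flip i x j = x j := by
  simp [flip, h]

lemma sgn_mul_self (i : Fin n) (x : Cube n) : sgn i x * sgn i x = 1 := by
  unfold sgn; split_ifs <;> norm_num

lemma abs_sgn (i : Fin n) (x : Cube n) : |sgn i x| = 1 := by
  unfold sgn; split_ifs <;> norm_num

lemma sgn_flip_self (i : Fin n) (x : Cube n) : sgn i (flip i x) = -sgn i x := by
  unfold sgn; cases h : x i <;> simp [h]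

lemma sgn_flip_of_ne {i j : Fin n} (h : j ≠ i) (x : Cube n) : sgn j (flip i x) = sgn j x := by
  simp [sgn, flip_apply_of_ne h]

lemma expect_involutive {ι : Type*} [Fintype ι] {e : ι → ι} (he : Function.Involutive e)
    (φ : ι → ℝ) : 𝔼 x, φ (e x) = 𝔼 x, φ x :=
  Fintype.expect_equiv he.toPerm _ _ fun _ => rfl

lemma expect_flip (i : Fin n) (φ : Cube n → ℝ) : 𝔼 x, φ (flip i x) = 𝔼 x, φ x :=
  expect_involutive (flip_flip i) φ

lemma expect_prod {ι κ : Type*} [Fintype ι] [Fintype κ] (φ : ι → κ → ℝ) :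
    𝔼 p : ι × κ, φ p.1 p.2 = 𝔼 x, 𝔼 y, φ x y := by
  rw [← Finset.expect_product' univ univ φ, univ_product_univ]

/-- Rerandomizing one coordinate does not change an average over a product space. -/
lemma expect_update {α : Type*} [Fintype α] [Nonempty α] (i : Fin n) (φ : (Fin n → α) → ℝ) :
    𝔼 s, 𝔼 a, φ (Function.update s i a) = 𝔼 s, φ s := by
  have he : Function.Involutive
      (fun p : (Fin n → α) × α => (Function.update p.1 i p.2, p.1 i)) := by
    rintro ⟨s, a⟩; simp
  rw [← expect_prod (fun s a => φ (Function.update s i a)),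
    expect_involutive he (fun p => φ p.1), expect_prod (fun s (_ : α) => φ s)]
  simp

lemma expect_sgn_mul_eq_zero (i : Fin n) {φ : Cube n → ℝ} (h : ∀ x, φ (flip i x) = φ x) :
    𝔼 x, sgn i x * φ x = 0 := by
  have := expect_flip i fun x => sgn i x * φ x
  simp only [h, sgn_flip_self, neg_mul, expect_neg_distrib] at this
  linarith

lemma expect_sgn_mul_sgn (i j : Fin n) :
    𝔼 x : Cube n, sgn i x * sgn j x = if i = j then 1 else 0 := by
  split_ifs with h
  · subst h; simp [sgn_mul_self]
  · exact expect_sgn_mul_eq_zero i fun x => sgn_flip_of_ne (Ne.symm h) x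

/-- Exchanging the coordinates in `K` between two independent uniform points leaves both uniform. -/
lemma expect_expect_piecewise (K : Finset (Fin n)) (φ : Cube n → ℝ) :
    𝔼 x, 𝔼 y, φ (K.piecewise x y) = 𝔼 x, φ x := by
  have he : Function.Involutive
      (fun p : Cube n × Cube n => (K.piecewise p.1 p.2, K.piecewise p.2 p.1)) := by
    rintro ⟨x, y⟩
    ext j <;> by_cases h : j ∈ K <;> simp [h]
  rw [← expect_prod (fun x y => φ (K.piecewise x y)),
    expect_involutive he (fun p => φ p.1), expect_prod (fun s (_ : Cube n) => φ s)]
  simp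

end Averages

/-! ### Isoperimetry with a vertex cover on the undirected cube -/

section Undirected

variable {n : ℕ}

/-- The average of `G` over the coordinates outside `K`, those in `K` being read off `x`. -/
noncomputable def condMean (K : Finset (Fin n)) (G : Cube n → ℝ) (x : Cube n) : ℝ :=
  𝔼 y, G (K.piecewise x y)

/-- The degree-one Fourier coefficient in direction `i` of `G` as a function of the coordinates
outside `K`, those in `K` being read off `x`. -/
noncomputable def condCoeff (K : Finset (Fin n)) (G : Cube n → ℝ) (i : Fin n) (x : Cube n) : ℝ :=
  𝔼 y, sgn i y * G (K.piecewise x y)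

/-- The second moment of the conditional mean of `G` given the coordinates in `K`. -/
noncomputable def condEnergy (K : Finset (Fin n)) (G : Cube n → ℝ) : ℝ :=
  𝔼 x, condMean K G x ^ 2

lemma piecewise_flip_left {K : Finset (Fin n)} {i : Fin n} (hi : i ∉ K) (x y : Cube n) :
    K.piecewise (flip i x) y = K.piecewise x y := by
  ext j
  by_cases hj : j ∈ K
  · simp [hj, flip_apply_of_ne (ne_of_mem_of_not_mem hj hi)]
  · simp [hj]

lemma piecewise_flip_right {K : Finset (Fin n)} {i : Fin n} (hi : i ∉ K) (x y : Cube n) :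
    K.piecewise x (flip i y) = flip i (K.piecewise x y) := by
  ext j
  by_cases hj : j ∈ K
  · simp [hj, flip_apply_of_ne (ne_of_mem_of_not_mem hj hi)]
  · by_cases h : j = i
    · subst h; simp [hj]
    · simp [hj, flip_apply_of_ne h]

lemma condMean_insert {K : Finset (Fin n)} {i : Fin n} (hi : i ∉ K) (G : Cube n → ℝ)
    (x : Cube n) :
    condMean (insert i K) G x = condMean K G x + sgn i x * condCoeff K G i x := by
  set Ψ : Cube n → ℝ := fun y => G (K.piecewise x y) with hΨ
  have h1 : ∀ y, G ((insert i K).piecewise x y) = Ψ (Function.update y i (x i)) := by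
    intro y
    simp only [hΨ]
    congr 1
    ext j
    by_cases h : j = i
    · subst h; simp [hi]
    · by_cases hj : j ∈ K <;> simp [hj, h]
  have h2 : ∀ y, 2 * Ψ (Function.update y i (x i)) =
      (Ψ y + sgn i x * (sgn i y * Ψ y)) +
        (Ψ (flip i y) + sgn i x * (sgn i (flip i y) * Ψ (flip i y))) := by
    intro y
    have h3 : Ψ (Function.update y i (x i)) = if x i = y i then Ψ y else Ψ (flip i y) := by
      split_ifs with h
      · rw [h, Function.update_eq_self]
      · have : x i = !y i := by revert h; cases x i <;> cases y i <;> simp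
        rw [this]; rfl
    rw [h3, sgn_flip_self]
    unfold sgn
    cases x i <;> cases y i <;> simp <;> ring
  have h4 : 2 * condMean (insert i K) G x = 2 * (condMean K G x + sgn i x * condCoeff K G i x) := by
    unfold condMean condCoeff
    simp only [h1]
    rw [mul_expect, expect_congr rfl fun y _ => h2 y, expect_add_distrib,
      expect_flip i fun y => Ψ y + sgn i x * (sgn i y * Ψ y), expect_add_distrib, mul_expect]
    ring
  linarith

lemma condEnergy_insert {K : Finset (Fin n)} {i : Fin n} (hi : i ∉ K) (G : Cube n → ℝ) :
    condEnergy (insert i K) G = condEnergy K G + 𝔼 x, condCoeff K G i x ^ 2 := by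
  have h0 : 𝔼 x, sgn i x * (2 * (condMean K G x * condCoeff K G i x)) = 0 := by
    apply expect_sgn_mul_eq_zero
    intro x
    simp [condMean, condCoeff, piecewise_flip_left hi]
  have h1 : ∀ x, condMean (insert i K) G x ^ 2 = condMean K G x ^ 2 + condCoeff K G i x ^ 2 +
      sgn i x * (2 * (condMean K G x * condCoeff K G i x)) := by
    intro x
    rw [condMean_insert hi]
    linear_combination condCoeff K G i x ^ 2 * sgn_mul_self i x
  unfold condEnergy
  rw [expect_congr rfl fun x _ => h1 x, expect_add_distrib, expect_add_distrib, h0, add_zero]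

lemma expect_sq_sum_mul_sgn (J : Finset (Fin n)) (a : Fin n → ℝ) :
    𝔼 y : Cube n, (∑ i ∈ J, a i * sgn i y) ^ 2 = ∑ i ∈ J, a i ^ 2 := by
  simp only [sq, sum_mul_sum]
  rw [expect_sum_comm]
  refine sum_congr rfl fun i hi => ?_
  rw [expect_sum_comm]
  have : ∀ j, 𝔼 y : Cube n, a i * sgn i y * (a j * sgn j y) =
      a i * a j * if i = j then 1 else 0 := by
    intro j
    rw [← expect_sgn_mul_sgn, mul_expect]
    exact expect_congr rfl fun y _ => by ring
  simp [this, hi]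

/-- Bessel's inequality for the degree-one characters. -/
lemma sum_sq_expect_sgn_mul_le (J : Finset (Fin n)) (ψ : Cube n → ℝ) (hψ : ∀ y, |ψ y| ≤ 1) :
    ∑ i ∈ J, (𝔼 y, sgn i y * ψ y) ^ 2 ≤ 1 := by
  set a : Fin n → ℝ := fun i => 𝔼 y, sgn i y * ψ y with ha
  have h1 : 𝔼 y, (∑ i ∈ J, a i * sgn i y) * ψ y = ∑ i ∈ J, a i ^ 2 := by
    simp only [sum_mul]
    rw [expect_sum_comm]
    refine sum_congr rfl fun i _ => ?_
    simp only [mul_assoc]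
    rw [← mul_expect, sq]
  have h2 := expect_sq_sum_mul_sgn J a
  have h3 : 0 ≤ 𝔼 y, (1 - 2 * ((∑ i ∈ J, a i * sgn i y) * ψ y) +
      (∑ i ∈ J, a i * sgn i y) ^ 2) := by
    refine expect_nonneg fun y _ => ?_
    have := (abs_le.1 (hψ y))
    have h4 : ψ y ^ 2 ≤ 1 := by rw [← sq_abs]; exact pow_le_one₀ (abs_nonneg _) (hψ y)
    nlinarith [sq_nonneg (ψ y - ∑ i ∈ J, a i * sgn i y)]
  rw [expect_add_distrib, expect_sub_distrib, ← mul_expect, h1, h2, Fintype.expect_const] at h3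
  linarith

/-- The energy increments over all directions outside `K` add up to at most a constant determined by
the sensitivity of `g` and by a vertex cover `U` of its sensitive edges. -/
lemma sum_condCoeff_sq_le (g U : Cube n → Bool)
    (hU : ∀ x i, g x ≠ g (flip i x) → U x = true ∨ U (flip i x) = true) {l : ℝ} (hl : 0 < l)
    (K : Finset (Fin n)) (x : Cube n) :
    ∑ i ∈ Kᶜ, condCoeff K (fun z => ind (g z)) i x ^ 2 ≤
      𝔼 y, (l * (∑ i, ind (g (K.piecewise x y) != g (flip i (K.piecewise x y)))) +
        l⁻¹ * ind (U (K.piecewise x y))) / 2 := by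
  set a : Fin n → ℝ := fun i => condCoeff K (fun z => ind (g z)) i x with ha
  set s : Fin n → Cube n → ℝ := fun i z => ind (g z != g (flip i z)) with hs
  have hs0 : ∀ i z, 0 ≤ s i z := fun i z => ind_nonneg _
  have hbessel : ∑ i ∈ Kᶜ, a i ^ 2 ≤ 1 :=
    sum_sq_expect_sgn_mul_le _ (fun y => ind (g (K.piecewise x y))) fun y => by
      rw [abs_of_nonneg (ind_nonneg _)]; exact ind_le_one _
  -- A sensitive edge contributes at most one half to the coefficient, and has an end in `U`.
  have hcoef : ∀ i ∈ Kᶜ, |a i| ≤ 𝔼 y, ind (U (K.piecewise x y)) * s i (K.piecewise x y) := by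
    intro i hi
    have hi' : i ∉ K := by simpa using hi
    have e1 := expect_flip i fun y => sgn i y * ind (g (K.piecewise x y))
    have e2 := expect_flip i fun y => ind (U (K.piecewise x y)) * s i (K.piecewise x y)
    simp only [piecewise_flip_right hi', sgn_flip_self] at e1 e2
    have e3 : 2 * a i = 𝔼 y, (sgn i y * ind (g (K.piecewise x y)) +
        -sgn i y * ind (g (flip i (K.piecewise x y)))) := by
      rw [expect_add_distrib, e1]; simp only [ha, condCoeff]; ring
    have e4 : 2 * 𝔼 y, ind (U (K.piecewise x y)) * s i (K.piecewise x y) =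
        𝔼 y, (ind (U (K.piecewise x y)) * s i (K.piecewise x y) +
          ind (U (flip i (K.piecewise x y))) * s i (flip i (K.piecewise x y))) := by
      rw [expect_add_distrib, e2]; ring
    have e5 : 2 * |a i| ≤ 2 * 𝔼 y, ind (U (K.piecewise x y)) * s i (K.piecewise x y) := by
      rw [e4, ← abs_two, ← abs_mul, e3]
      refine (abs_expect_le _ _).trans (expect_le_expect fun y _ => ?_)
      set z := K.piecewise x y
      have h := hU z i
      have hab : |sgn i y * ind (g z) + -sgn i y * ind (g (flip i z))| =
          |ind (g z) - ind (g (flip i z))| := by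
        rw [show sgn i y * ind (g z) + -sgn i y * ind (g (flip i z)) =
          sgn i y * (ind (g z) - ind (g (flip i z))) by ring, abs_mul, abs_sgn, one_mul]
      rw [hab]
      simp only [hs, flip_flip]
      revert h
      cases g z <;> cases g (flip i z) <;> cases U z <;> cases U (flip i z) <;> simp [ind]
    linarith
  calc ∑ i ∈ Kᶜ, a i ^ 2
      ≤ ∑ i ∈ Kᶜ, |a i| * 𝔼 y, ind (U (K.piecewise x y)) * s i (K.piecewise x y) := by
        refine sum_le_sum fun i hi => ?_
        rw [← sq_abs, sq]
        exact mul_le_mul_of_nonneg_left (hcoef i hi) (abs_nonneg _)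
    _ = 𝔼 y, ∑ i ∈ Kᶜ, |a i| * (ind (U (K.piecewise x y)) * s i (K.piecewise x y)) := by
        rw [expect_sum_comm]
        exact sum_congr rfl fun i _ => mul_expect _ _ _
    _ ≤ _ := by
        refine expect_le_expect fun y _ => ?_
        set z := K.piecewise x y
        have hterm : ∀ i, |a i| * (ind (U z) * s i z) ≤
            (l * s i z + l⁻¹ * ind (U z) * a i ^ 2) / 2 := by
          intro i
          have h1 : l⁻¹ * l = 1 := inv_mul_cancel₀ hl.ne'
          have h2 : 0 ≤ l⁻¹ := inv_nonneg.2 hl.le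
          have h3 : 2 * |a i| ≤ l + l⁻¹ * a i ^ 2 := by
            have : 0 ≤ l⁻¹ * (l - |a i|) ^ 2 := mul_nonneg h2 (sq_nonneg _)
            have e : l⁻¹ * (l - |a i|) ^ 2 = l⁻¹ * l * l - 2 * (l⁻¹ * l) * |a i| + l⁻¹ * a i ^ 2 := by
              rw [← sq_abs (a i)]; ring
            rw [e, h1] at this; linarith
          have h4 : 0 ≤ l⁻¹ * a i ^ 2 := mul_nonneg h2 (sq_nonneg _)
          have hs' : s i z = 0 ∨ s i z = 1 := by
            simp only [hs, ind]; split_ifs <;> simp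
          have hu' : ind (U z) = 0 ∨ ind (U z) = 1 := by
            simp only [ind]; split_ifs <;> simp
          rcases hs' with h | h <;> rcases hu' with h' | h' <;> rw [h, h'] <;> simp <;> linarith
        calc ∑ i ∈ Kᶜ, |a i| * (ind (U z) * s i z)
            ≤ ∑ i ∈ Kᶜ, (l * s i z + l⁻¹ * ind (U z) * a i ^ 2) / 2 :=
              sum_le_sum fun i _ => hterm i
          _ = (l * ∑ i ∈ Kᶜ, s i z + l⁻¹ * ind (U z) * ∑ i ∈ Kᶜ, a i ^ 2) / 2 := by
              rw [← sum_div, sum_add_distrib, mul_sum, mul_sum]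
          _ ≤ (l * ∑ i, s i z + l⁻¹ * ind (U z) * 1) / 2 := by
              have : ∑ i ∈ Kᶜ, s i z ≤ ∑ i, s i z :=
                sum_le_sum_of_subset_of_nonneg (subset_univ _) fun i _ _ => hs0 i z
              have h5 : 0 ≤ l⁻¹ * ind (U z) := mul_nonneg (inv_nonneg.2 hl.le) (ind_nonneg _)
              gcongr
          _ = _ := by rw [mul_one]

/-- If the increments of a set function out of every set have total at most `M`, then adding the
elements greedily in the cheapest order costs at most `M` times a harmonic number. -/
lemma sub_le_mul_harmonic {ι : Type*} [Fintype ι] [DecidableEq ι] (v : Finset ι → ℝ) {M : ℝ}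
    (h : ∀ K, ∑ i ∈ Kᶜ, (v (insert i K) - v K) ≤ M) :
    ∀ (k : ℕ) (K : Finset ι), Kᶜ.card = k → v univ - v K ≤ M * (harmonic k : ℝ) := by
  intro k
  induction k with
  | zero =>
    intro K hK
    have : K = univ := by simpa using hK
    simp [this]
  | succ k ih =>
    intro K hK
    have hne : Kᶜ.Nonempty := by rw [← card_pos, hK]; omega
    obtain ⟨i, hi, hle⟩ : ∃ i ∈ Kᶜ, v (insert i K) - v K ≤ M / (k + 1) := by
      refine exists_le_of_sum_le hne ?_
      rw [sum_const, hK, nsmul_eq_mul]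
      refine (h K).trans (le_of_eq ?_)
      push_cast
      field_simp
    have hc : (insert i K)ᶜ.card = k := by
      rw [compl_insert, card_erase_of_mem hi, hK]; rfl
    have := ih _ hc
    rw [harmonic_succ]
    push_cast
    have e : M * ((harmonic k : ℝ) + ((k : ℝ) + 1)⁻¹) = M * (harmonic k : ℝ) + M / (k + 1) := by
      ring
    rw [e]
    linarith

/-- An isoperimetric inequality with a vertex cover: if `U` covers the sensitive edges of `g`, then
the values of `g` at antipodal points differ rarely unless `g` has large average sensitivity or `U`
is large. -/
theorem expect_ne_compl_le (g U : Cube n → Bool)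
    (hU : ∀ x i, g x ≠ g (flip i x) → U x = true ∨ U (flip i x) = true) {l : ℝ} (hl : 0 < l) :
    𝔼 x, ind (g x != g xᶜ) ≤ 2 * (harmonic n : ℝ) *
      (l * (𝔼 x, ∑ i, ind (g x != g (flip i x))) + l⁻¹ * 𝔼 x, ind (U x)) := by
  set G : Cube n → ℝ := fun z => ind (g z) with hG
  set M : ℝ := 𝔼 z, (l * (∑ i, ind (g z != g (flip i z))) + l⁻¹ * ind (U z)) / 2 with hM
  have hinc : ∀ K : Finset (Fin n),
      ∑ i ∈ Kᶜ, (condEnergy (insert i K) G - condEnergy K G) ≤ M := by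
    intro K
    calc ∑ i ∈ Kᶜ, (condEnergy (insert i K) G - condEnergy K G)
        = ∑ i ∈ Kᶜ, 𝔼 x, condCoeff K G i x ^ 2 := by
          refine sum_congr rfl fun i hi => ?_
          rw [condEnergy_insert (by simpa using hi)]; ring
      _ = 𝔼 x, ∑ i ∈ Kᶜ, condCoeff K G i x ^ 2 := (expect_sum_comm _ _ _).symm
      _ ≤ 𝔼 x, 𝔼 y, (l * (∑ i, ind (g (K.piecewise x y) != g (flip i (K.piecewise x y)))) +
            l⁻¹ * ind (U (K.piecewise x y))) / 2 :=
          expect_le_expect fun x _ => sum_condCoeff_sq_le g U hU hl K x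
      _ = M := expect_expect_piecewise K fun z =>
          (l * (∑ i, ind (g z != g (flip i z))) + l⁻¹ * ind (U z)) / 2
  have hvar := sub_le_mul_harmonic (fun K => condEnergy K G) hinc n ∅ (by simp)
  have hfull : condEnergy univ G = 𝔼 x, G x ^ 2 := by simp [condEnergy, condMean]
  set μ : ℝ := 𝔼 x, G x with hμ
  have hempty : condEnergy ∅ G = μ ^ 2 := by simp [condEnergy, condMean, hμ]
  have hMe : M = (l * (𝔼 x, ∑ i, ind (g x != g (flip i x))) + l⁻¹ * 𝔼 x, ind (U x)) / 2 := by
    rw [hM, ← expect_div, expect_add_distrib, ← mul_expect, ← mul_expect]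
  have hpt : ∀ x, ind (g x != g xᶜ) ≤ 2 * (G x - μ) ^ 2 + 2 * (G xᶜ - μ) ^ 2 := by
    intro x
    have : ind (g x != g xᶜ) = (G x - G xᶜ) ^ 2 := by
      simp only [hG]; cases g x <;> cases g xᶜ <;> simp [ind]
    rw [this]
    nlinarith [sq_nonneg (G x + G xᶜ - 2 * μ)]
  have hcomp : 𝔼 x : Cube n, (G xᶜ - μ) ^ 2 = 𝔼 x, (G x - μ) ^ 2 :=
    expect_involutive compl_involutive fun x => (G x - μ) ^ 2
  have hv : 𝔼 x : Cube n, (G x - μ) ^ 2 = 𝔼 x, G x ^ 2 - μ ^ 2 := by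
    have : ∀ x, (G x - μ) ^ 2 = G x ^ 2 - 2 * μ * G x + μ ^ 2 := fun x => by ring
    rw [expect_congr rfl fun x _ => this x, expect_add_distrib, expect_sub_distrib, ← mul_expect,
      Fintype.expect_const, ← hμ]
    ring
  calc 𝔼 x, ind (g x != g xᶜ) ≤ 𝔼 x, (2 * (G x - μ) ^ 2 + 2 * (G xᶜ - μ) ^ 2) :=
        expect_le_expect fun x _ => hpt x
    _ = 4 * (condEnergy univ G - condEnergy ∅ G) := by
        rw [expect_add_distrib, ← mul_expect, ← mul_expect, hcomp, hv, hfull, hempty]; ring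
    _ ≤ 4 * (M * (harmonic n : ℝ)) := by linarith
    _ = _ := by rw [hMe]; ring

end Undirected

/-! ### Sorting operators -/

section Sorting

variable {n : ℕ}

/-- Sorting in direction `i`: the two values of `f` on each edge in direction `i` are arranged in
increasing order. -/
def sortDir (i : Fin n) (f : Cube n → Bool) : Cube n → Bool := fun x =>
  if x i then f (Function.update x i false) || f (Function.update x i true)
  else f (Function.update x i false) && f (Function.update x i true)

/-- Sorting successively in the directions of a list, the head of the list first. -/
def sortList (L : List (Fin n)) (f : Cube n → Bool) : Cube n → Bool :=
  L.foldl (fun h i => sortDir i h) f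

/-- The fraction of points at which `f` and `g` differ, as an average. -/
noncomputable def discrepancy (f g : Cube n → Bool) : ℝ := 𝔼 x, ind (f x != g x)

/-- The fraction of points lying on an edge in direction `i` along which `f` decreases. -/
noncomputable def violation (i : Fin n) (f : Cube n → Bool) : ℝ :=
  𝔼 x, ind (f (Function.update x i false) && !f (Function.update x i true))

/-- `f` does not decrease along edges in direction `i`. -/
def MonoDir (i : Fin n) (f : Cube n → Bool) : Prop :=
  ∀ x, f (Function.update x i false) ≤ f (Function.update x i true)

/-- `f ≤ g`, and `f` at the lower end of an edge is at most `g` at its upper end. For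
`f ≤ h ≤ g` it follows that the points where `f < g` cover the edges along which `h` decreases. -/
def EdgeDominated (f g : Cube n → Bool) : Prop :=
  f ≤ g ∧ ∀ i x, f (Function.update x i false) ≤ g (Function.update x i true)

@[simp] lemma sortList_nil (f : Cube n → Bool) : sortList [] f = f := rfl

@[simp] lemma sortList_cons (i : Fin n) (L : List (Fin n)) (f : Cube n → Bool) :
    sortList (i :: L) f = sortList L (sortDir i f) := rfl

lemma sortList_append (L L' : List (Fin n)) (f : Cube n → Bool) :
    sortList (L ++ L') f = sortList L' (sortList L f) := by
  simp [sortList, List.foldl_append]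

lemma sortDir_mono (i : Fin n) : Monotone (sortDir i) := by
  intro f g h x
  have h0 : f (Function.update x i false) ≤ g (Function.update x i false) := h _
  have h1 : f (Function.update x i true) ≤ g (Function.update x i true) := h _
  revert h0 h1
  change _ → _ → sortDir i f x ≤ sortDir i g x
  unfold sortDir
  generalize f (Function.update x i false) = a
  generalize f (Function.update x i true) = b
  generalize g (Function.update x i false) = c
  generalize g (Function.update x i true) = d
  generalize x i = e
  revert a b c d e
  decide

lemma sortList_mono (L : List (Fin n)) : Monotone (sortList L) := by
  induction L with
  | nil => exact monotone_id
  | cons i L ih => exact ih.comp (sortDir_mono i)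

lemma expect_le_of_flip (i : Fin n) {φ ψ : Cube n → ℝ}
    (h : ∀ x, φ x + φ (flip i x) ≤ ψ x + ψ (flip i x)) : 𝔼 x, φ x ≤ 𝔼 x, ψ x := by
  have := expect_le_expect fun x (_ : x ∈ (univ : Finset (Cube n))) => h x
  rw [expect_add_distrib, expect_add_distrib, expect_flip i φ, expect_flip i ψ] at this
  linarith

/-- To compare averages it is enough to compare sums over the edges in one direction. -/
lemma expect_le_of_edge (i : Fin n) {φ ψ : Cube n → ℝ}
    (h : ∀ x, φ (Function.update x i false) + φ (Function.update x i true) ≤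
      ψ (Function.update x i false) + ψ (Function.update x i true)) :
    𝔼 x, φ x ≤ 𝔼 x, ψ x := by
  refine expect_le_of_flip i fun x => ?_
  have h' := h x
  have e : Function.update x i (x i) = x := Function.update_eq_self i x
  unfold flip
  cases hx : x i <;> rw [hx] at e <;> rw [e] at h' <;> simp only [Bool.not_true, Bool.not_false] <;>
    linarith

lemma sortDir_update_false (i : Fin n) (f : Cube n → Bool) (x : Cube n) :
    sortDir i f (Function.update x i false) =
      (f (Function.update x i false) && f (Function.update x i true)) := by
  simp [sortDir]

lemma sortDir_update_true (i : Fin n) (f : Cube n → Bool) (x : Cube n) :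
    sortDir i f (Function.update x i true) =
      (f (Function.update x i false) || f (Function.update x i true)) := by
  simp [sortDir]

lemma sortDir_update_of_ne {i j : Fin n} (h : j ≠ i) (f : Cube n → Bool) (x : Cube n) (b : Bool) :
    sortDir j f (Function.update x i b) =
      if x j then f (Function.update (Function.update x j false) i b) ||
        f (Function.update (Function.update x j true) i b)
      else f (Function.update (Function.update x j false) i b) &&
        f (Function.update (Function.update x j true) i b) := by
  simp only [sortDir, Function.update_of_ne h, Function.update_comm h]

/-- Sorting does not increase the distance between two functions. -/
lemma discrepancy_sortDir_le (i : Fin n) (f g : Cube n → Bool) :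
    discrepancy (sortDir i f) (sortDir i g) ≤ discrepancy f g := by
  refine expect_le_of_edge i fun x => ?_
  simp only [sortDir_update_false, sortDir_update_true]
  cases f (Function.update x i false) <;> cases f (Function.update x i true) <;>
    cases g (Function.update x i false) <;> cases g (Function.update x i true) <;> norm_num [ind]

lemma discrepancy_sortList_le (L : List (Fin n)) (f g : Cube n → Bool) :
    discrepancy (sortList L f) (sortList L g) ≤ discrepancy f g := by
  induction L generalizing f g with
  | nil => exact le_rfl
  | cons i L ih => exact (ih _ _).trans (discrepancy_sortDir_le i f g)

lemma expect_ind_sortDir (i : Fin n) (f : Cube n → Bool) :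
    𝔼 x, ind (sortDir i f x) = 𝔼 x, ind (f x) := by
  refine le_antisymm (expect_le_of_edge i fun x => ?_) (expect_le_of_edge i fun x => ?_) <;>
    simp only [sortDir_update_false, sortDir_update_true] <;>
    cases f (Function.update x i false) <;> cases f (Function.update x i true) <;> norm_num [ind]

lemma discrepancy_self_sortDir (i : Fin n) (f : Cube n → Bool) :
    discrepancy f (sortDir i f) = violation i f := by
  refine expect_congr rfl fun x _ => ?_
  have e : Function.update x i (x i) = x := Function.update_eq_self i x
  unfold sortDir
  cases hx : x i <;> rw [hx] at e <;> nth_rewrite 1 [← e] <;>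
    cases f (Function.update x i false) <;> cases f (Function.update x i true) <;> simp [ind]

/-- Sorting does not increase the number of decreasing edges in any direction. -/
lemma violation_sortDir_le (i j : Fin n) (f : Cube n → Bool) :
    violation i (sortDir j f) ≤ violation i f := by
  by_cases h : j = i
  · subst h
    refine expect_le_expect fun x _ => ?_
    rw [sortDir_update_false, sortDir_update_true]
    cases f (Function.update x j false) <;> cases f (Function.update x j true) <;> norm_num [ind]
  · refine expect_le_of_edge j fun x => ?_
    simp only [sortDir_update_of_ne h, Function.update_self, Function.update_idem]
    cases f (Function.update (Function.update x j false) i false) <;>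
      cases f (Function.update (Function.update x j false) i true) <;>
      cases f (Function.update (Function.update x j true) i false) <;>
      cases f (Function.update (Function.update x j true) i true) <;> norm_num [ind]

lemma violation_sortList_le (i : Fin n) (L : List (Fin n)) (f : Cube n → Bool) :
    violation i (sortList L f) ≤ violation i f := by
  induction L generalizing f with
  | nil => exact le_rfl
  | cons j L ih => exact (ih _).trans (violation_sortDir_le i j f)

lemma monoDir_sortDir_self (i : Fin n) (f : Cube n → Bool) : MonoDir i (sortDir i f) := by
  intro x
  rw [sortDir_update_false, sortDir_update_true]
  cases f (Function.update x i false) <;> cases f (Function.update x i true) <;> decide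

lemma MonoDir.sortDir {i : Fin n} {f : Cube n → Bool} (hf : MonoDir i f) (j : Fin n) :
    MonoDir i (sortDir j f) := by
  by_cases h : j = i
  · subst h; exact monoDir_sortDir_self j f
  · intro x
    rw [sortDir_update_of_ne h, sortDir_update_of_ne h]
    have h0 := hf (Function.update x j false)
    have h1 := hf (Function.update x j true)
    revert h0 h1
    generalize f (Function.update (Function.update x j false) i false) = a
    generalize f (Function.update (Function.update x j false) i true) = b
    generalize f (Function.update (Function.update x j true) i false) = c
    generalize f (Function.update (Function.update x j true) i true) = d
    generalize x j = e
    revert a b c d e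
    decide

lemma MonoDir.sortList {i : Fin n} {f : Cube n → Bool} (hf : MonoDir i f) (L : List (Fin n)) :
    MonoDir i (sortList L f) := by
  induction L generalizing f with
  | nil => exact hf
  | cons j L ih => exact ih (hf.sortDir j)

lemma monoDir_sortList_of_mem {i : Fin n} {L : List (Fin n)} (hi : i ∈ L) (f : Cube n → Bool) :
    MonoDir i (sortList L f) := by
  induction L generalizing f with
  | nil => simp at hi
  | cons j L ih =>
    rcases List.mem_cons.1 hi with h | h
    · subst h; exact (monoDir_sortDir_self i f).sortList L
    · exact ih h _

lemma MonoDir.sortDir_eq {i : Fin n} {f : Cube n → Bool} (hf : MonoDir i f) :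
    MonotonicityTesting.sortDir i f = f := by
  ext x
  have e : Function.update x i (x i) = x := Function.update_eq_self i x
  have h := hf x
  unfold MonotonicityTesting.sortDir
  cases hx : x i <;> rw [hx] at e <;> rw [e] at h ⊢ <;> revert h
  · cases f x <;> cases f (Function.update x i true) <;> simp
  · cases f x <;> cases f (Function.update x i false) <;> simp

lemma sortList_eq_self {L : List (Fin n)} {f : Cube n → Bool} (h : ∀ i ∈ L, MonoDir i f) :
    sortList L f = f := by
  induction L with
  | nil => rfl
  | cons i L ih =>
    rw [sortList_cons, (h i (by simp)).sortDir_eq]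
    exact ih fun j hj => h j (by simp [hj])

lemma sortList_sortList_self (L : List (Fin n)) (f : Cube n → Bool) :
    sortList L (sortList L f) = sortList L f :=
  sortList_eq_self fun _ hi => monoDir_sortList_of_mem hi f

/-- A function that is monotone along the edges in every direction is monotone. -/
lemma monotone_of_monoDir {f : Cube n → Bool} (h : ∀ i, MonoDir i f) : Monotone f := by
  intro x y hxy
  have key : ∀ s : Finset (Fin n), f x ≤ f (s.piecewise y x) := by
    intro s
    induction s using Finset.induction_on with
    | empty => simp
    | insert i s hi ih =>
      refine ih.trans ?_
      have e : Function.update (s.piecewise y x) i (x i) = s.piecewise y x := by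
        conv_rhs => rw [← Function.update_eq_self i (s.piecewise y x)]
        simp [hi]
      rw [piecewise_insert]
      have hxyi : x i ≤ y i := hxy i
      have hm := h i (s.piecewise y x)
      revert hxyi
      cases hx : x i <;> cases hy : y i <;> rw [hx] at e <;> intro hle
      · rw [e]
      · nth_rewrite 1 [← e]; exact hm
      · exact absurd hle (by decide)
      · rw [e]
  simpa using key univ

lemma EdgeDominated.sortDir {f g : Cube n → Bool} (h : EdgeDominated f g) (j : Fin n) :
    EdgeDominated (sortDir j f) (sortDir j g) := by
  refine ⟨sortDir_mono j h.1, fun i x => ?_⟩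
  by_cases hji : j = i
  · subst hji
    rw [sortDir_update_false, sortDir_update_true]
    have h0 := h.2 j x
    revert h0
    cases f (Function.update x j false) <;> cases g (Function.update x j true) <;> simp
  · rw [sortDir_update_of_ne hji, sortDir_update_of_ne hji]
    have h0 := h.2 i (Function.update x j false)
    have h1 := h.2 i (Function.update x j true)
    revert h0 h1
    generalize f (Function.update (Function.update x j false) i false) = a
    generalize g (Function.update (Function.update x j false) i true) = b
    generalize f (Function.update (Function.update x j true) i false) = c
    generalize g (Function.update (Function.update x j true) i true) = d
    generalize x j = e
    revert a b c d e
    decide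

lemma EdgeDominated.sortList {f g : Cube n → Bool} (h : EdgeDominated f g) (L : List (Fin n)) :
    EdgeDominated (sortList L f) (sortList L g) := by
  induction L generalizing f g with
  | nil => exact h
  | cons j L ih => exact ih (h.sortDir j)

lemma EdgeDominated.le_sortDir {f g : Cube n → Bool} (h : EdgeDominated f g) (i : Fin n) :
    f ≤ MonotonicityTesting.sortDir i g := by
  intro x
  have e : Function.update x i (x i) = x := Function.update_eq_self i x
  have h0 := h.2 i x
  have h1 := h.1 x
  unfold MonotonicityTesting.sortDir
  revert h0 h1
  cases hx : x i <;> rw [hx] at e <;> rw [e]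
  · cases f x <;> cases g x <;> cases g (Function.update x i true) <;> simp
  · cases f x <;> cases g x <;> cases g (Function.update x i false) <;> simp

lemma EdgeDominated.sortDir_le {f g : Cube n → Bool} (h : EdgeDominated f g) (i : Fin n) :
    MonotonicityTesting.sortDir i f ≤ g := by
  intro x
  have e : Function.update x i (x i) = x := Function.update_eq_self i x
  have h0 := h.2 i x
  have h1 := h.1 x
  unfold MonotonicityTesting.sortDir
  revert h0 h1
  cases hx : x i <;> rw [hx] at e <;> rw [e]
  · cases f x <;> cases g x <;> cases f (Function.update x i true) <;> simp
  · cases f x <;> cases g x <;> cases f (Function.update x i false) <;> simp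

/-- Negating one coordinate of `S` changes the sublist of `L` selected by `S` by at most one
entry. -/
lemma filter_flip_cases {L : List (Fin n)} (hL : L.Nodup) (S : Cube n) (i : Fin n) :
    L.filter (flip i S) = L.filter S ∨
      ∃ A B, (L.filter S = A ++ B ∧ L.filter (flip i S) = A ++ i :: B) ∨
        (L.filter (flip i S) = A ++ B ∧ L.filter S = A ++ i :: B) := by
  have hne : ∀ L' : List (Fin n), i ∉ L' → L'.filter (flip i S) = L'.filter S := fun L' h =>
    List.filter_congr fun j hj => flip_apply_of_ne (ne_of_mem_of_not_mem hj h) S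
  by_cases hi : i ∈ L
  · right
    obtain ⟨A, B, rfl⟩ := List.append_of_mem hi
    have hA : i ∉ A := fun h => by
      have := List.disjoint_of_nodup_append hL
      exact this h (by simp)
    have hB : i ∉ B := by
      have := (List.nodup_append.1 hL).2.1
      exact (List.nodup_cons.1 this).1
    refine ⟨A.filter S, B.filter S, ?_⟩
    simp only [List.filter_append, List.filter_cons, hne A hA, hne B hB, flip_apply_self]
    cases S i <;> simp
  · exact Or.inl (hne L hi)

lemma discrepancy_comm (f g : Cube n → Bool) : discrepancy f g = discrepancy g f :=
  expect_congr rfl fun x _ => by rw [bne_comm]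

lemma discrepancy_self (f : Cube n → Bool) : discrepancy f f = 0 :=
  expect_eq_zero fun x _ => by simp [ind]

lemma discrepancy_triangle (f g h : Cube n → Bool) :
    discrepancy f h ≤ discrepancy f g + discrepancy g h := by
  unfold discrepancy
  rw [← expect_add_distrib]
  refine expect_le_expect fun x _ => ?_
  cases f x <;> cases g x <;> cases h x <;> norm_num [ind]

lemma discrepancy_sortList_insert_le (A B : List (Fin n)) (i : Fin n) (f : Cube n → Bool) :
    discrepancy (sortList (A ++ B) f) (sortList (A ++ i :: B) f) ≤ violation i f := by
  rw [sortList_append, sortList_append, sortList_cons]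
  refine (discrepancy_sortList_le B _ _).trans ?_
  rw [discrepancy_self_sortDir]
  exact violation_sortList_le i A f

lemma violation_nonneg (i : Fin n) (f : Cube n → Bool) : 0 ≤ violation i f :=
  expect_nonneg fun _ _ => ind_nonneg _

lemma discrepancy_filter_flip_le {L : List (Fin n)} (hL : L.Nodup) (S : Cube n) (i : Fin n)
    (f : Cube n → Bool) :
    discrepancy (sortList (L.filter S) f) (sortList (L.filter (flip i S)) f) ≤ violation i f := by
  rcases filter_flip_cases hL S i with h | ⟨A, B, ⟨h, h'⟩ | ⟨h, h'⟩⟩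
  · rw [h, discrepancy_self]; exact violation_nonneg i f
  · rw [h, h']; exact discrepancy_sortList_insert_le A B i f
  · rw [h, h', discrepancy_comm]; exact discrepancy_sortList_insert_le A B i f

lemma EdgeDominated.sortList_filter_le {f g : Cube n → Bool} (h : EdgeDominated f g)
    {L : List (Fin n)} (hL : L.Nodup) (S : Cube n) (i : Fin n) :
    MonotonicityTesting.sortList (L.filter S) f ≤
      MonotonicityTesting.sortList (L.filter (flip i S)) g := by
  rcases filter_flip_cases hL S i with e | ⟨A, B, ⟨e, e'⟩ | ⟨e, e'⟩⟩
  · rw [e]; exact sortList_mono _ h.1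
  · rw [e, e', sortList_append, sortList_append, sortList_cons]
    exact sortList_mono B ((h.sortList A).le_sortDir i)
  · rw [e, e', sortList_append, sortList_append, sortList_cons]
    exact sortList_mono B ((h.sortList A).sortDir_le i)

lemma discrepancy_sortList_eq {f g : Cube n → Bool} (h : f ≤ g) (L : List (Fin n)) :
    discrepancy (sortList L f) (sortList L g) = discrepancy f g := by
  have key : ∀ f g : Cube n → Bool, f ≤ g →
      discrepancy f g = 𝔼 x, ind (g x) - 𝔼 x, ind (f x) := by
    intro f g h
    rw [← expect_sub_distrib]
    refine expect_congr rfl fun x _ => ?_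
    have := h x
    revert this
    cases f x <;> cases g x <;> simp [ind]
  have hc : ∀ f : Cube n → Bool, 𝔼 x, ind (sortList L f x) = 𝔼 x, ind (f x) := by
    clear key h
    induction L with
    | nil => exact fun f => rfl
    | cons i L ih => intro f; rw [sortList_cons, ih, expect_ind_sortDir]
  rw [key _ _ (sortList_mono L h), key _ _ h, hc, hc]

/-- Sorting `f` in a random set of directions and in the complementary set gives nearby functions
if `f` has few decreasing edges or these have a small vertex cover. For fixed `x` the value at `x`
of the function sorted in the directions `S` is a Boolean function of `S`; a change of this value
when `S` changes in one direction comes from a decreasing edge of `f`. -/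
theorem expect_discrepancy_sortList_compl_le {f fm fp : Cube n → Bool} (hm : fm ≤ f) (hp : f ≤ fp)
    (h : EdgeDominated fm fp) {L : List (Fin n)} (hL : L.Nodup) {l : ℝ} (hl : 0 < l) :
    𝔼 S : Cube n, discrepancy (sortList (L.filter S) f) (sortList (L.filter Sᶜ) f) ≤
      2 * (harmonic n : ℝ) * (l * ∑ i, violation i f + l⁻¹ * discrepancy fm fp) := by
  have hx : ∀ x : Cube n,
      𝔼 S : Cube n, ind (sortList (L.filter S) f x != sortList (L.filter Sᶜ) f x) ≤
        2 * (harmonic n : ℝ) * (l * (𝔼 S : Cube n, ∑ i,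
          ind (sortList (L.filter S) f x != sortList (L.filter (flip i S)) f x)) +
          l⁻¹ * 𝔼 S : Cube n,
            ind (sortList (L.filter S) fm x != sortList (L.filter S) fp x)) := by
    intro x
    refine expect_ne_compl_le (fun S => sortList (L.filter S) f x)
      (fun S => sortList (L.filter S) fm x != sortList (L.filter S) fp x) (fun S i hne => ?_) hl
    have a1 : sortList (L.filter S) fm x ≤ sortList (L.filter (flip i S)) fp x :=
      h.sortList_filter_le hL S i x
    have a2 : sortList (L.filter (flip i S)) fm x ≤ sortList (L.filter S) fp x := by
      simpa using h.sortList_filter_le hL (flip i S) i x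
    have b : ∀ T : Cube n, sortList (L.filter T) fm x ≤ sortList (L.filter T) f x ∧
        sortList (L.filter T) f x ≤ sortList (L.filter T) fp x := fun T =>
      ⟨sortList_mono (L.filter T) hm x, sortList_mono (L.filter T) hp x⟩
    have b1 := b S
    have b2 := b (flip i S)
    revert a1 a2 b1 b2 hne
    generalize sortList (L.filter S) fm x = c1
    generalize sortList (L.filter S) f x = c2
    generalize sortList (L.filter S) fp x = c3
    generalize sortList (L.filter (flip i S)) fm x = d1
    generalize sortList (L.filter (flip i S)) f x = d2
    generalize sortList (L.filter (flip i S)) fp x = d3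
    revert c1 c2 c3 d1 d2 d3
    decide
  have hH : (0 : ℝ) ≤ harmonic n := by
    exact_mod_cast sum_nonneg fun i _ => by positivity
  calc 𝔼 S : Cube n, discrepancy (sortList (L.filter S) f) (sortList (L.filter Sᶜ) f)
      = 𝔼 x : Cube n,
          𝔼 S : Cube n, ind (sortList (L.filter S) f x != sortList (L.filter Sᶜ) f x) :=
        expect_comm _ _ _
    _ ≤ _ := expect_le_expect fun x _ => hx x
    _ = 2 * (harmonic n : ℝ) * (l * (𝔼 S : Cube n, ∑ i,
          discrepancy (sortList (L.filter S) f) (sortList (L.filter (flip i S)) f)) +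
          l⁻¹ * 𝔼 S : Cube n,
            discrepancy (sortList (L.filter S) fm) (sortList (L.filter S) fp)) := by
        rw [← mul_expect, expect_add_distrib, ← mul_expect, ← mul_expect]
        congr 2
        · rw [expect_comm]
          refine congrArg (l * ·) (expect_congr rfl fun S _ => ?_)
          rw [expect_sum_comm]; rfl
        · rw [expect_comm]; rfl
    _ ≤ _ := by
        have h1 : 𝔼 S : Cube n, ∑ i,
            discrepancy (sortList (L.filter S) f) (sortList (L.filter (flip i S)) f) ≤
            ∑ i, violation i f :=
          expect_le univ_nonempty fun S _ =>
            sum_le_sum fun i _ => discrepancy_filter_flip_le hL S i f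
        have h2 : 𝔼 S : Cube n, discrepancy (sortList (L.filter S) fm) (sortList (L.filter S) fp) =
            discrepancy fm fp := by
          simp only [discrepancy_sortList_eq h.1, Fintype.expect_const]
        rw [h2]
        gcongr

end Sorting

/-! ### Directed isoperimetry -/

section Directed

variable {n : ℕ}

lemma dist_eq_discrepancy (f g : Cube n → Bool) : dist f g = discrepancy f g := by
  unfold dist discrepancy
  rw [Fintype.expect_eq_sum_div_card]
  congr 1
  · rw [card_filter]
    push_cast
    refine sum_congr rfl fun x _ => ?_
    cases f x <;> cases g x <;> simp [ind]
  · simp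

lemma discrepancy_le_one (f g : Cube n → Bool) : discrepancy f g ≤ 1 :=
  expect_le univ_nonempty fun _ _ => ind_le_one _

/-- Let `δ` bound the average distance between sorting in a random set of directions and in the
complementary set. Then there are a random set `R` containing each direction with probability
`2⁻ᵐ` and a random order in which to sort such that sorting in all directions of a list `L` and
sorting in those that lie in `R` give functions at average distance at most `m * δ`. The order puts,
recursively, the directions outside a random half before those inside it. -/
lemma exists_random_order {f : Cube n → Bool} {δ : ℝ}
    (hδ : ∀ L : List (Fin n), L.Nodup →
      𝔼 S : Cube n, discrepancy (sortList (L.filter S) f) (sortList (L.filter Sᶜ) f) ≤ δ) (m : ℕ) :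
    ∃ (Ω : Type) (_ : Fintype Ω) (_ : Nonempty Ω) (R : Ω → Cube n)
      (ord : Ω → List (Fin n) → List (Fin n)),
      (∀ ω L, (ord ω L).Perm L) ∧ (∀ i, 𝔼 ω, ind (R ω i) = (1 / 2) ^ m) ∧
      ∀ L : List (Fin n), L.Nodup →
        𝔼 ω, discrepancy (sortList (L.filter (R ω)) f) (sortList (ord ω L) f) ≤ m * δ := by
  induction m with
  | zero =>
    refine ⟨Unit, inferInstance, inferInstance, fun _ _ => true, fun _ L => L,
      fun _ _ => List.Perm.refl _, fun i => by simp [ind], fun L _ => ?_⟩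
    have : L.filter (fun _ => true) = L := List.filter_eq_self.2 fun _ _ => rfl
    simp [this, discrepancy_self]
  | succ m ih =>
    obtain ⟨Ω, _, _, R, ord, hperm, hR, hd⟩ := ih
    have hsplit : ∀ (b : Cube n) (L : List (Fin n)), (L.filter bᶜ ++ L.filter b).Perm L :=
      fun b L => List.perm_append_comm.trans (List.filter_append_perm b L)
    refine ⟨Cube n × Ω, inferInstance, inferInstance, fun p i => R p.2 i && p.1 i,
      fun p L => ord p.2 (L.filter p.1ᶜ ++ L.filter p.1),
      fun p L => (hperm _ _).trans (hsplit _ _), fun i => ?_, fun L hL => ?_⟩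
    · rw [expect_prod (fun (b : Cube n) ω => ind (R ω i && b i))]
      have h1 : ∀ (b : Cube n) ω, ind (R ω i && b i) = ind (b i) * ind (R ω i) := by
        intro b ω; cases R ω i <;> cases b i <;> simp [ind]
      have h2 : 𝔼 b : Cube n, ind (b i) = 1 / 2 := by
        have e := expect_flip i fun b => ind (b i)
        have e' : 𝔼 b : Cube n, (ind (b i) + ind (flip i b i)) = 1 := by
          rw [← Fintype.expect_const (ι := Cube n) (1 : ℝ)]
          refine expect_congr rfl fun b _ => ?_
          rw [flip_apply_self]; cases b i <;> simp [ind]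
        rw [expect_add_distrib, e] at e'
        linarith
      simp only [h1, ← mul_expect, hR, ← expect_mul, h2]
      ring
    · have hstep : ∀ (b : Cube n) ω,
          discrepancy (sortList (L.filter fun i => R ω i && b i) f)
            (sortList (ord ω (L.filter bᶜ ++ L.filter b)) f) ≤
          discrepancy (sortList ((L.filter (R ω)).filter b) f)
            (sortList ((L.filter (R ω)).filter bᶜ) f) +
          discrepancy (sortList ((L.filter bᶜ ++ L.filter b).filter (R ω)) f)
            (sortList (ord ω (L.filter bᶜ ++ L.filter b)) f) := by
        intro b ω
        refine (discrepancy_triangle _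
          (sortList ((L.filter bᶜ ++ L.filter b).filter (R ω)) f) _).trans ?_
        gcongr
        have e1 : (L.filter fun i => R ω i && b i) = (L.filter (R ω)).filter b := by
          rw [List.filter_filter]
          exact List.filter_congr fun i _ => Bool.and_comm _ _
        have e2 : (L.filter bᶜ ++ L.filter b).filter (R ω) =
            (L.filter (R ω)).filter bᶜ ++ (L.filter (R ω)).filter b := by
          simp only [List.filter_append, List.filter_filter, Bool.and_comm]
        -- Sorting twice in the same directions changes nothing, and sorting is a contraction.
        rw [e1, e2, sortList_append]
        nth_rewrite 1 [← sortList_sortList_self]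
        exact discrepancy_sortList_le _ _ _
      rw [expect_prod (fun (b : Cube n) ω =>
        discrepancy (sortList (L.filter fun i => R ω i && b i) f)
            (sortList (ord ω (L.filter bᶜ ++ L.filter b)) f))]
      refine (expect_le_expect fun b _ => expect_le_expect fun ω _ => hstep b ω).trans ?_
      simp only [expect_add_distrib]
      have h1 : 𝔼 b : Cube n, 𝔼 ω, discrepancy (sortList ((L.filter (R ω)).filter b) f)
            (sortList ((L.filter (R ω)).filter bᶜ) f) ≤ δ := by
        rw [expect_comm]
        exact expect_le univ_nonempty fun ω _ => hδ _ (hL.filter _)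
      have h2 : 𝔼 b : Cube n, 𝔼 ω,
          discrepancy (sortList ((L.filter bᶜ ++ L.filter b).filter (R ω)) f)
            (sortList (ord ω (L.filter bᶜ ++ L.filter b)) f) ≤ m * δ :=
        expect_le univ_nonempty fun b _ => hd _ ((hsplit b L).nodup_iff.2 hL)
      push_cast
      linarith

/-- A directed isoperimetric inequality: a function far from monotone has many decreasing edges, or
these have no small vertex cover. -/
theorem le_of_farFromMonotone {f fm fp : Cube n → Bool} {ε : ℝ} (hf : FarFromMonotone ε f)
    (hm : fm ≤ f) (hp : f ≤ fp) (h : EdgeDominated fm fp) {l : ℝ} (hl : 0 < l) (m : ℕ) :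
    ε ≤ m * (2 * (harmonic n : ℝ) * (l * ∑ i, violation i f + l⁻¹ * discrepancy fm fp)) +
      n * (1 / 2) ^ m := by
  obtain ⟨Ω, _, _, R, ord, hperm, hR, hd⟩ := exists_random_order (f := f)
    (fun L hL => expect_discrepancy_sortList_compl_le hm hp h hL hl) m
  have hfin := hd _ (List.nodup_finRange n)
  have hω : ∀ ω, ε ≤ ∑ i, ind (R ω i) +
      discrepancy (sortList ((List.finRange n).filter (R ω)) f)
        (sortList (ord ω (List.finRange n)) f) := by
    intro ω
    have hmono : Monotone (sortList (ord ω (List.finRange n)) f) :=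
      monotone_of_monoDir fun i =>
        monoDir_sortList_of_mem ((hperm ω _).mem_iff.2 (List.mem_finRange i)) f
    have h1 : ε ≤ discrepancy f (sortList (ord ω (List.finRange n)) f) := by
      by_contra hlt
      exact hf ⟨_, hmono, by rw [dist_eq_discrepancy]; linarith⟩
    refine h1.trans ((discrepancy_triangle _
      (sortList ((List.finRange n).filter (R ω)) f) _).trans ?_)
    gcongr
    by_cases hi : ∃ i, R ω i = true
    · obtain ⟨i, hi⟩ := hi
      refine (discrepancy_le_one _ _).trans ?_
      have : ind (R ω i) = 1 := by simp [ind, hi]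
      rw [← this]
      exact single_le_sum (f := fun i => ind (R ω i)) (fun j _ => ind_nonneg _) (mem_univ i)
    · push Not at hi
      have : (List.finRange n).filter (R ω) = [] :=
        List.filter_eq_nil_iff.2 fun i _ => hi i
      rw [this, sortList_nil, discrepancy_self]
      exact sum_nonneg fun _ _ => ind_nonneg _
  have := le_expect univ_nonempty fun ω (_ : ω ∈ univ) => hω ω
  rw [expect_add_distrib, expect_sum_comm] at this
  simp only [hR, sum_const, card_univ, Fintype.card_fin, nsmul_eq_mul] at this
  linarith

end Directed

/-! ### Random directed walks -/

section Walk

variable {n k : ℕ}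

/-- The fraction of points lying on an edge in direction `i` along which `f` is not constant. -/
noncomputable def influence (i : Fin n) (f : Cube n → Bool) : ℝ :=
  𝔼 x, ind (f (Function.update x i false) != f (Function.update x i true))

/-- The point `y` with the coordinates in `{j ∈ A | s j = 0}` set to `false`. For uniform `s` each
coordinate in `A` is selected independently with probability `1 / (k + 1)`. -/
def lowerOn (A : Finset (Fin n)) (y : Cube n) (s : Fin n → Fin (k + 1)) : Cube n :=
  fun j => if j ∈ A ∧ s j = 0 then false else y j

/-- The point `y` with the coordinates in `{j | s j = 0}` set to `false`. -/
def lower (y : Cube n) (s : Fin n → Fin (k + 1)) : Cube n := fun j => if s j = 0 then false else y j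

/-- The point `y` with the coordinates in `{j | s j = 0}` set to `true`. -/
def upper (y : Cube n) (s : Fin n → Fin (k + 1)) : Cube n := fun j => if s j = 0 then true else y j

/-- The density of the distribution of `lowerOn A y s`, for uniform `y` and `s`, with respect to the
uniform distribution, where `p = 1 / (k + 1)`. -/
noncomputable def walkDensity (p : ℝ) (A : Finset (Fin n)) (z : Cube n) : ℝ :=
  ∏ j ∈ A, if z j then 1 - p else 1 + p

lemma expect_eq_of_edge (i : Fin n) {φ ψ : Cube n → ℝ}
    (h : ∀ x, φ (Function.update x i false) + φ (Function.update x i true) =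
      ψ (Function.update x i false) + ψ (Function.update x i true)) :
    𝔼 x, φ x = 𝔼 x, ψ x :=
  le_antisymm (expect_le_of_edge i fun x => (h x).le) (expect_le_of_edge i fun x => (h x).ge)

/-- The event `s i = 0` is independent of the other coordinates of `s`. -/
lemma expect_ind_eq_zero_mul (i : Fin n) {φ : (Fin n → Fin (k + 1)) → ℝ}
    (h : ∀ s a, φ (Function.update s i a) = φ s) :
    𝔼 s, ind (s i == 0) * φ s = 1 / (k + 1) * 𝔼 s, φ s := by
  rw [← expect_update i]
  simp only [h, Function.update_self, ← expect_mul]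
  rw [← mul_expect]
  congr 1
  rw [Fintype.expect_eq_sum_div_card]
  simp [ind]

lemma lowerOn_update {A : Finset (Fin n)} {i : Fin n} (hi : i ∉ A) (y : Cube n)
    (s : Fin n → Fin (k + 1)) (a : Fin (k + 1)) :
    lowerOn A y (Function.update s i a) = lowerOn A y s := by
  ext j
  by_cases hj : j = i
  · subst hj; simp [lowerOn, hi]
  · simp [lowerOn, hj]

lemma lowerOn_empty (y : Cube n) (s : Fin n → Fin (k + 1)) : lowerOn ∅ y s = y := by
  ext j; simp [lowerOn]

lemma lowerOn_insert {A : Finset (Fin n)} {i : Fin n} (y : Cube n) (s : Fin n → Fin (k + 1)) :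
    lowerOn (insert i A) y s =
      if s i = 0 then Function.update (lowerOn A y s) i false else lowerOn A y s := by
  ext j
  by_cases hj : j = i
  · subst hj
    by_cases h : s j = 0 <;> simp [lowerOn, h]
  · by_cases h : s i = 0 <;> simp [lowerOn, h, hj]

lemma expect_expect_lowerOn (A : Finset (Fin n)) (φ : Cube n → ℝ) :
    𝔼 y, 𝔼 s : Fin n → Fin (k + 1), φ (lowerOn A y s) =
      𝔼 z, walkDensity (1 / (k + 1)) A z * φ z := by
  induction A using Finset.induction_on generalizing φ with
  | empty => simp [lowerOn_empty, walkDensity]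
  | insert i A hi ih =>
    set p : ℝ := 1 / (k + 1) with hp
    have h1 : ∀ y, 𝔼 s : Fin n → Fin (k + 1), φ (lowerOn (insert i A) y s) =
        𝔼 s : Fin n → Fin (k + 1), (p * φ (Function.update (lowerOn A y s) i false) +
          (1 - p) * φ (lowerOn A y s)) := by
      intro y
      have e : ∀ s : Fin n → Fin (k + 1), φ (lowerOn (insert i A) y s) =
          φ (lowerOn A y s) + ind (s i == 0) *
            (φ (Function.update (lowerOn A y s) i false) - φ (lowerOn A y s)) := by
        intro s
        rw [lowerOn_insert]
        by_cases h : s i = 0 <;> simp [h, ind]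
      simp only [e]
      rw [expect_add_distrib, expect_ind_eq_zero_mul i fun s a => by rw [lowerOn_update hi],
        expect_sub_distrib, expect_add_distrib, ← mul_expect, ← mul_expect]
      ring
    simp only [h1]
    rw [ih fun z => p * φ (Function.update z i false) + (1 - p) * φ z]
    refine expect_eq_of_edge i fun z => ?_
    have hA : ∀ b, walkDensity p A (Function.update z i b) = walkDensity p A z := fun b =>
      prod_congr rfl fun j hj => by rw [Function.update_of_ne (ne_of_mem_of_not_mem hj hi)]
    have hins : ∀ b, walkDensity p (insert i A) (Function.update z i b) =
        (if b then 1 - p else 1 + p) * walkDensity p A z := by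
      intro b
      rw [← hA b]
      unfold walkDensity
      rw [prod_insert hi, Function.update_self]
    simp only [hA, hins, Function.update_idem]
    simp
    ring

lemma expect_prod_apply (A : Finset (Fin n)) (c : Bool → ℝ) :
    𝔼 z : Cube n, ∏ j ∈ A, c (z j) = ((c true + c false) / 2) ^ A.card := by
  induction A using Finset.induction_on with
  | empty => simp
  | insert i A hi ih =>
    rw [card_insert_of_notMem hi, pow_succ', ← ih, mul_expect]
    refine expect_eq_of_edge i fun z => ?_
    have hA : ∀ b, ∏ j ∈ A, c (Function.update z i b j) = ∏ j ∈ A, c (z j) := fun b =>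
      prod_congr rfl fun j hj => by rw [Function.update_of_ne (ne_of_mem_of_not_mem hj hi)]
    simp only [prod_insert hi, hA, Function.update_self]
    ring

/-- High moments of the density of the walk stay bounded while the walk is short compared with the
width of the middle layers. -/
lemma expect_walkDensity_pow_le {p : ℝ} (hp0 : 0 ≤ p) (hp1 : p ≤ 1) (A : Finset (Fin n)) {r : ℕ}
    (h : n * p ^ 2 * r ^ 2 ≤ 1) : 𝔼 z : Cube n, walkDensity p A z ^ r ≤ 2 := by
  have h1 : 𝔼 z : Cube n, walkDensity p A z ^ r =
      (((1 - p) ^ r + (1 + p) ^ r) / 2) ^ A.card := by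
    have := expect_prod_apply A fun b => (if b then 1 - p else 1 + p) ^ r
    simp only [if_true, Bool.false_eq_true, if_false] at this
    rw [← this]
    exact expect_congr rfl fun z _ => (prod_pow _ _ _).symm
  have h2 : ((1 - p) ^ r + (1 + p) ^ r) / 2 ≤ Real.exp ((p * r) ^ 2 / 2) := by
    refine le_trans ?_ (Real.cosh_le_exp_half_sq _)
    rw [Real.cosh_eq]
    have e1 : (1 + p) ^ r ≤ Real.exp (p * r) := by
      rw [mul_comm, Real.exp_nat_mul]
      exact pow_le_pow_left₀ (by linarith) (by linarith [Real.add_one_le_exp p]) _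
    have e2 : (1 - p) ^ r ≤ Real.exp (-(p * r)) := by
      rw [← neg_mul, mul_comm, Real.exp_nat_mul]
      exact pow_le_pow_left₀ (by linarith) (by linarith [Real.add_one_le_exp (-p)]) _
    linarith
  have h0 : 0 ≤ ((1 - p) ^ r + (1 + p) ^ r) / 2 := by
    have : 0 ≤ 1 - p := by linarith
    positivity
  rw [h1]
  calc (((1 - p) ^ r + (1 + p) ^ r) / 2) ^ A.card
      ≤ Real.exp ((p * r) ^ 2 / 2) ^ A.card := pow_le_pow_left₀ h0 h2 _
    _ = Real.exp (A.card * ((p * r) ^ 2 / 2)) := (Real.exp_nat_mul _ _).symm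
    _ ≤ Real.exp (1 / 2) := by
        apply Real.exp_le_exp.2
        have : (A.card : ℝ) ≤ n := by exact_mod_cast (card_le_univ A).trans_eq (by simp)
        have h3 : (A.card : ℝ) * (p * r) ^ 2 ≤ n * (p * r) ^ 2 := by gcongr
        rw [mul_pow] at h3 ⊢
        linarith
    _ ≤ 2 := by
        have e : Real.exp (1 / 2) ^ 2 = Real.exp 1 := by
          rw [← Real.exp_nat_mul]; norm_num
        nlinarith [Real.exp_one_lt_d9, Real.exp_pos (1 / 2 : ℝ)]

/-- A function of total influence `I` changes its value along the random walk with probability at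
most about `2 * I / (k + 1)`. Where the density of the walk is at most `2`, the steps are compared
with uniform edges; the rest has negligible weight because the moments of the density are
bounded. -/
theorem expect_ne_lower_le {r : ℕ} (h : n * (1 / ((k : ℝ) + 1)) ^ 2 * ((r : ℝ) + 1) ^ 2 ≤ 1)
    (hr : n ≤ 2 ^ r) (f : Cube n → Bool) :
    𝔼 y, 𝔼 s : Fin n → Fin (k + 1), ind (f y != f (lower y s)) ≤
      1 / (k + 1) * (2 * ∑ i, influence i f + 2) := by
  set p : ℝ := 1 / (k + 1) with hp
  have hp0 : 0 ≤ p := by positivity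
  have hp1 : p ≤ 1 := by
    rw [hp, div_le_one (by positivity)]
    linarith [(Nat.cast_nonneg k : (0 : ℝ) ≤ k)]
  have hdens : ∀ A : Finset (Fin n), ∀ i, 𝔼 z, walkDensity p A z *
      ind (f (Function.update z i false) != f (Function.update z i true)) ≤
      2 * influence i f + 2 / 2 ^ r := by
    intro A i
    have hw : ∀ z, 0 ≤ walkDensity p A z := fun z =>
      prod_nonneg fun j _ => by split_ifs <;> linarith
    have hpt : ∀ z, walkDensity p A z *
        ind (f (Function.update z i false) != f (Function.update z i true)) ≤
        2 * ind (f (Function.update z i false) != f (Function.update z i true)) +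
          walkDensity p A z ^ (r + 1) / 2 ^ r := by
      intro z
      set w := walkDensity p A z
      have h0 := ind_nonneg (f (Function.update z i false) != f (Function.update z i true))
      have h1 := ind_le_one (f (Function.update z i false) != f (Function.update z i true))
      have hq : 0 ≤ w ^ (r + 1) / 2 ^ r := by have := hw z; positivity
      rcases le_total w 2 with h2 | h2
      · nlinarith
      · have : w ≤ w ^ (r + 1) / 2 ^ r := by
          rw [le_div_iff₀ (by positivity), pow_succ']
          exact mul_le_mul_of_nonneg_left (pow_le_pow_left₀ (by norm_num) h2 r) (hw z)
        nlinarith [hw z]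
    refine (expect_le_expect fun z _ => hpt z).trans ?_
    rw [expect_add_distrib, ← mul_expect, ← expect_div]
    have := expect_walkDensity_pow_le (n := n) hp0 hp1 A (r := r + 1) (by push_cast; exact h)
    unfold influence
    gcongr
  have hA : ∀ A : Finset (Fin n),
      𝔼 y, 𝔼 s : Fin n → Fin (k + 1), ind (f y != f (lowerOn A y s)) ≤
        ∑ i ∈ A, p * (2 * influence i f + 2 / 2 ^ r) := by
    intro A
    induction A using Finset.induction_on with
    | empty => simp [lowerOn_empty, ind]
    | insert i A hi ih =>
      have hpt : ∀ y (s : Fin n → Fin (k + 1)), ind (f y != f (lowerOn (insert i A) y s)) ≤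
          ind (f y != f (lowerOn A y s)) + ind (s i == 0) *
            ind (f (Function.update (lowerOn A y s) i false) !=
              f (Function.update (lowerOn A y s) i true)) := by
        intro y s
        rw [lowerOn_insert]
        by_cases h : s i = 0
        · set z := lowerOn A y s
          have e : Function.update z i (z i) = z := Function.update_eq_self i z
          rw [if_pos h]
          have e1 : ind (s i == 0) = 1 := by simp [ind, h]
          rw [e1, one_mul]
          cases hz : z i <;> rw [hz] at e <;> rw [e]
          · have := ind_nonneg (f z != f (Function.update z i true)); linarith
          · cases f y <;> cases f z <;> cases f (Function.update z i false) <;> norm_num [ind]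
        · rw [if_neg h]
          have := mul_nonneg (ind_nonneg (s i == 0))
            (ind_nonneg (f (Function.update (lowerOn A y s) i false) !=
              f (Function.update (lowerOn A y s) i true)))
          linarith
      rw [sum_insert hi]
      refine (expect_le_expect fun y _ => expect_le_expect fun s _ => hpt y s).trans ?_
      simp only [expect_add_distrib]
      have e2 : ∀ y, 𝔼 s : Fin n → Fin (k + 1), ind (s i == 0) *
            ind (f (Function.update (lowerOn A y s) i false) !=
              f (Function.update (lowerOn A y s) i true)) =
          p * 𝔼 s : Fin n → Fin (k + 1), ind (f (Function.update (lowerOn A y s) i false) !=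
              f (Function.update (lowerOn A y s) i true)) := fun y =>
        expect_ind_eq_zero_mul i fun s a => by rw [lowerOn_update hi]
      simp only [e2, ← mul_expect]
      rw [expect_expect_lowerOn A fun z =>
        ind (f (Function.update z i false) != f (Function.update z i true))]
      have := mul_le_mul_of_nonneg_left (hdens A i) hp0
      linarith
  have hlow : ∀ y (s : Fin n → Fin (k + 1)), lower y s = lowerOn univ y s := by
    intro y s; ext j; simp [lower, lowerOn]
  simp only [hlow]
  refine (hA univ).trans ?_
  rw [← mul_sum, sum_add_distrib, ← mul_sum, sum_const, card_univ, Fintype.card_fin, nsmul_eq_mul]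
  have : (n : ℝ) * (2 / 2 ^ r) ≤ 2 := by
    rw [mul_div_assoc', div_le_iff₀ (by positivity)]
    have : (n : ℝ) ≤ 2 ^ r := by exact_mod_cast hr
    linarith
  gcongr

lemma compl_update (x : Cube n) (i : Fin n) (b : Bool) :
    (Function.update x i b)ᶜ = Function.update xᶜ i !b := by
  ext j
  by_cases hj : j = i
  · subst hj; simp
  · simp [hj]

/-- The upward walk is the downward walk for `fun x => f xᶜ`, seen through complementation. -/
theorem expect_ne_upper_le {r : ℕ} (h : n * (1 / ((k : ℝ) + 1)) ^ 2 * ((r : ℝ) + 1) ^ 2 ≤ 1)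
    (hr : n ≤ 2 ^ r) (f : Cube n → Bool) :
    𝔼 y, 𝔼 s : Fin n → Fin (k + 1), ind (f y != f (upper y s)) ≤
      1 / (k + 1) * (2 * ∑ i, influence i f + 2) := by
  have h1 := expect_ne_lower_le h hr fun x => f xᶜ
  have h2 : ∀ i, influence i (fun x => f xᶜ) = influence i f := by
    intro i
    rw [influence, influence, ← expect_involutive (compl_involutive (α := Cube n)) fun x =>
      ind (f (Function.update x i false) != f (Function.update x i true))]
    refine expect_congr rfl fun x _ => ?_
    rw [compl_update, compl_update, bne_comm]; rfl
  simp only [h2] at h1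
  refine le_trans (le_of_eq ?_) h1
  rw [← expect_involutive (compl_involutive (α := Cube n)) fun y =>
    𝔼 s : Fin n → Fin (k + 1), ind (f y != f (upper y s))]
  refine expect_congr rfl fun y _ => expect_congr rfl fun s _ => ?_
  have : upper yᶜ s = (lower y s)ᶜ := by
    ext j; by_cases h : s j = 0 <;> simp [upper, lower, h]
  rw [this]

/-- The total influence of a monotone function is at most of order `√n`, by orthogonality of the
degree-one characters, and each decreasing edge adds at most its own contribution twice. -/
theorem sum_influence_le (hn : 0 < n) (f : Cube n → Bool) :
    ∑ i, influence i f ≤ 2 * √n + 2 * ∑ i, violation i f := by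
  have h1 : ∀ i, influence i f = 2 * 𝔼 x, sgn i x * ind (f x) + 2 * violation i f := by
    intro i
    unfold influence violation
    rw [mul_expect, mul_expect, ← expect_add_distrib]
    refine expect_eq_of_edge i fun x => ?_
    simp only [Function.update_idem, sgn, Function.update_self]
    cases f (Function.update x i false) <;> cases f (Function.update x i true) <;> norm_num [ind]
  have hs : 0 < √(n : ℝ) := Real.sqrt_pos.2 (by exact_mod_cast hn)
  have h2 : ∑ i : Fin n, 𝔼 x, sgn i x * ind (f x) ≤ √n := by
    rw [← expect_sum_comm]
    have hpt : ∀ x, ∑ i, sgn i x * ind (f x) ≤ (√n + (∑ i, 1 * sgn i x) ^ 2 / √n) / 2 := by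
      intro x
      rw [← sum_mul]
      simp only [one_mul]
      set t := ∑ i, sgn i x
      have h3 : 2 * |t| ≤ √n + t ^ 2 / √n := by
        have e : √n + t ^ 2 / √n - 2 * |t| = (√n - |t|) ^ 2 / √n := by
          rw [sub_sq, sq_abs]; field_simp; ring
        have : 0 ≤ (√n - |t|) ^ 2 / √n := by positivity
        linarith
      have h4 : t * ind (f x) ≤ |t| := by
        cases f x <;> simp [ind, le_abs_self]
      linarith
    refine (expect_le_expect fun x _ => hpt x).trans ?_
    rw [← expect_div, expect_add_distrib, ← expect_div,
      expect_sq_sum_mul_sgn univ fun _ => (1 : ℝ), Fintype.expect_const]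
    simp only [one_pow, sum_const, card_univ, Fintype.card_fin, nsmul_eq_mul, mul_one,
      Real.div_sqrt]
    linarith
  simp only [h1, sum_add_distrib, ← mul_sum]
  linarith

/-- A set of pairwise disjoint edges along which `f` decreases, each given by its lower end and its
direction. A lower end is never an upper end, since `f` takes different values there. -/
def IsDecreasingMatching (f : Cube n → Bool) (M : Finset (Cube n × Fin n)) : Prop :=
  (∀ e ∈ M, e.1 e.2 = false ∧ f e.1 = true ∧ f (flip e.2 e.1) = false) ∧
    Set.InjOn Prod.fst (M : Set (Cube n × Fin n)) ∧
    Set.InjOn (fun e => flip e.2 e.1) (M : Set (Cube n × Fin n))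

/-- A random short walk through an edge of the matching is likely to start in `f = 1` and to end in
`f = 0`, since `f` rarely changes on the way to the edge and after it. -/
theorem le_expect_lower_upper {f : Cube n → Bool} {M : Finset (Cube n × Fin n)}
    (hM : IsDecreasingMatching f M) {r : ℕ}
    (h : n * (1 / ((k : ℝ) + 1)) ^ 2 * ((r : ℝ) + 1) ^ 2 ≤ 1) (hr : n ≤ 2 ^ r) :
    1 / (k + 1) * ((M.card : ℝ) / 2 ^ n - 2 * (1 / (k + 1) * (2 * ∑ i, influence i f + 2))) ≤
      𝔼 x, 𝔼 s : Fin n → Fin (k + 1), ind (f (lower x s) && !f (upper x s)) := by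
  obtain ⟨hM1, hM2, hM3⟩ := hM
  set p : ℝ := 1 / (k + 1) with hp
  have hp0 : 0 ≤ p := by positivity
  set Ψ : Cube n → ℝ := fun x =>
    𝔼 s : Fin n → Fin (k + 1), ind (f (lower x s) && !f (upper x s)) with hΨ
  set a : Cube n → ℝ := fun y => 𝔼 s : Fin n → Fin (k + 1), ind (f y != f (lower y s)) with ha
  set b : Cube n → ℝ := fun y => 𝔼 s : Fin n → Fin (k + 1), ind (f y != f (upper y s)) with hb
  have ha0 : ∀ y, 0 ≤ a y := fun y => expect_nonneg fun _ _ => ind_nonneg _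
  have hb0 : ∀ y, 0 ≤ b y := fun y => expect_nonneg fun _ _ => ind_nonneg _
  have hΨ0 : ∀ y, 0 ≤ Ψ y := fun y => expect_nonneg fun _ _ => ind_nonneg _
  have hedge : ∀ e ∈ M, p * (1 - a e.1 - b (flip e.2 e.1)) ≤ Ψ e.1 := by
    rintro ⟨y, i⟩ he
    obtain ⟨hyi, hf1, hf0⟩ := hM1 _ he
    dsimp only at hyi hf1 hf0 ⊢
    -- Since `y i` is `false`, the walks down from `y` and up from `flip i y` ignore `s i`.
    have hl : ∀ (s : Fin n → Fin (k + 1)) c, lower y (Function.update s i c) = lower y s := by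
      intro s c
      ext j
      by_cases hj : j = i
      · subst hj; simp [lower, hyi]
      · simp [lower, hj]
    have hu : ∀ (s : Fin n → Fin (k + 1)) c,
        upper (flip i y) (Function.update s i c) = upper (flip i y) s := by
      intro s c
      ext j
      by_cases hj : j = i
      · subst hj; simp [upper, hyi]
      · simp [upper, hj]
    have hind := expect_ind_eq_zero_mul i (φ := fun s : Fin n → Fin (k + 1) =>
      1 - ind (f y != f (lower y s)) - ind (f (flip i y) != f (upper (flip i y) s)))
      fun s c => by rw [hl, hu]
    rw [expect_sub_distrib, expect_sub_distrib, Fintype.expect_const] at hind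
    change p * (1 - a y - b (flip i y)) ≤ Ψ y
    rw [← hind]
    refine expect_le_expect fun s _ => ?_
    by_cases hs : s i = 0
    · have e : upper (flip i y) s = upper y s := by
        ext j
        by_cases hj : j = i
        · subst hj; simp [upper, hs]
        · simp [upper, flip_apply_of_ne hj]
      rw [e, hf1, hf0]
      simp only [hs]
      cases f (lower y s) <;> cases f (upper y s) <;> norm_num [ind]
    · have : ind (s i == 0) = 0 := by simp [ind, hs]
      rw [this, zero_mul]
      exact ind_nonneg _
  have hsum : ∀ φ : Cube n → ℝ, 𝔼 x, φ x = (∑ x, φ x) / 2 ^ n := by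
    intro φ
    rw [Fintype.expect_eq_sum_div_card]; simp
  have hinj : ∀ {φ : Cube n → ℝ} (_ : ∀ x, 0 ≤ φ x) {v : Cube n × Fin n → Cube n}
      (_ : Set.InjOn v M), ∑ e ∈ M, φ (v e) ≤ ∑ x, φ x := by
    intro φ h0 v hv
    rw [← sum_image (f := φ) hv]
    exact sum_le_sum_of_subset_of_nonneg (subset_univ _) fun x _ _ => h0 x
  have hA := expect_ne_lower_le h hr f
  have hB := expect_ne_upper_le h hr f
  change 𝔼 y, a y ≤ _ at hA
  change 𝔼 y, b y ≤ _ at hB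
  change _ ≤ 𝔼 x, Ψ x
  rw [hsum, div_le_iff₀ (by positivity)] at hA hB
  rw [hsum, le_div_iff₀ (by positivity)]
  have h1 := sum_le_sum hedge
  rw [← mul_sum, sum_sub_distrib, sum_sub_distrib, sum_const, nsmul_eq_mul, mul_one] at h1
  have h2 := hinj hΨ0 hM2
  have h3 := hinj ha0 hM2
  have h4 := hinj hb0 hM3
  refine le_trans (le_trans ?_ h1) h2
  rw [mul_assoc]
  refine mul_le_mul_of_nonneg_left ?_ hp0
  have e : (M.card : ℝ) / 2 ^ n * 2 ^ n = M.card := div_mul_cancel₀ _ (by positivity)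
  rw [sub_mul, e]
  linarith

end Walk

/-! ### Maximal matchings of decreasing edges -/

section Matching

variable {n : ℕ}

/-- The ends of a maximal matching of decreasing edges cover all decreasing edges. -/
theorem exists_matching_edgeDominated (f : Cube n → Bool) :
    ∃ (M : Finset (Cube n × Fin n)) (fm fp : Cube n → Bool), IsDecreasingMatching f M ∧
      fm ≤ f ∧ f ≤ fp ∧ EdgeDominated fm fp ∧
      discrepancy fm fp ≤ 2 * ((M.card : ℝ) / 2 ^ n) := by
  classical
  obtain ⟨M, hM, hmax⟩ := exists_max_image
    (univ.filter fun M : Finset (Cube n × Fin n) => IsDecreasingMatching f M) card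
    ⟨∅, by simp [IsDecreasingMatching]⟩
  rw [mem_filter] at hM
  obtain ⟨-, hM⟩ := hM
  set V := M.image Prod.fst with hV
  set W := M.image fun e => flip e.2 e.1 with hW
  have hle : (fun x => f x && !decide (x ∈ V)) ≤ f := fun x => by
    dsimp only; cases f x <;> simp
  have hge : f ≤ fun x => f x || decide (x ∈ W) := fun x => by
    dsimp only; cases f x <;> simp
  refine ⟨M, fun x => f x && !decide (x ∈ V), fun x => f x || decide (x ∈ W), hM,
    hle, hge, ⟨hle.trans hge, fun i x => ?_⟩, ?_⟩
  · by_contra hcon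
    set x0 := Function.update x i false with hx0
    have hx1 : Function.update x i true = flip i x0 := by simp [flip, hx0]
    have h0i : x0 i = false := by simp [hx0]
    rw [hx1] at hcon
    have h : f x0 = true ∧ x0 ∉ V ∧ f (flip i x0) = false ∧ flip i x0 ∉ W := by
      revert hcon
      by_cases a : x0 ∈ V <;> by_cases b : flip i x0 ∈ W <;> cases c : f x0 <;>
        cases d : f (flip i x0) <;> simp [a, b, c, d]
    obtain ⟨h1, h2, h3, h4⟩ := h
    have hnot : (x0, i) ∉ M := fun hmem => h2 (mem_image_of_mem Prod.fst hmem)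
    have hins : IsDecreasingMatching f (insert (x0, i) M) := by
      obtain ⟨hM1, hM2, hM3⟩ := hM
      refine ⟨fun e he => ?_, ?_, ?_⟩
      · rcases mem_insert.1 he with rfl | he
        · exact ⟨h0i, h1, h3⟩
        · exact hM1 e he
      · rw [coe_insert, Set.injOn_insert (by exact_mod_cast hnot)]
        exact ⟨hM2, by rwa [← coe_image, mem_coe]⟩
      · rw [coe_insert, Set.injOn_insert (by exact_mod_cast hnot)]
        exact ⟨hM3, by rwa [← coe_image, mem_coe]⟩
    have := hmax _ (mem_filter.2 ⟨mem_univ _, hins⟩)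
    rw [card_insert_of_notMem hnot] at this
    omega
  · have hpt : ∀ x, ind ((f x && !decide (x ∈ V)) != (f x || decide (x ∈ W))) ≤
        (if x ∈ V then 1 else 0) + if x ∈ W then 1 else 0 := by
      intro x
      by_cases a : x ∈ V <;> by_cases b : x ∈ W <;> cases f x <;> norm_num [a, b, ind]
    refine (expect_le_expect fun x _ => hpt x).trans ?_
    rw [Fintype.expect_eq_sum_div_card, sum_add_distrib, sum_boole, sum_boole]
    have e1 : (univ.filter (· ∈ V)).card ≤ M.card := by
      rw [filter_mem_eq_inter, univ_inter]; exact card_image_le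
    have e2 : (univ.filter (· ∈ W)).card ≤ M.card := by
      rw [filter_mem_eq_inter, univ_inter]; exact card_image_le
    have e1' : ((univ.filter (· ∈ V)).card : ℝ) ≤ M.card := by exact_mod_cast e1
    have e2' : ((univ.filter (· ∈ W)).card : ℝ) ≤ M.card := by exact_mod_cast e2
    have hc : (Fintype.card (Cube n) : ℝ) = 2 ^ n := by simp
    rw [hc, mul_div_assoc']
    gcongr
    linarith

end Matching

/-! ### Testers from random comparable pairs -/

section Tester

variable {n : ℕ}

/-- The deterministic algorithm that queries `f` at `t` pairs of points and answers "Yes" unless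
some pair has the values `true` and `false`, in this order. -/
def pairTester {t : ℕ} (lo hi : Fin t → Cube n) : DetNonadaptive n (2 * t) where
  query q := if (finProdFinEquiv.symm q).1 = 0 then lo (finProdFinEquiv.symm q).2
    else hi (finProdFinEquiv.symm q).2
  verdict a := decide (∀ j : Fin t,
    ¬(a (finProdFinEquiv (0, j)) = true ∧ a (finProdFinEquiv (1, j)) = false))

lemma pairTester_output {t : ℕ} (lo hi : Fin t → Cube n) (f : Cube n → Bool) :
    (pairTester lo hi).output f =
      decide (∀ j, ¬(f (lo j) = true ∧ f (hi j) = false)) := by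
  simp only [DetNonadaptive.output, pairTester, Equiv.symm_apply_apply]
  simp

/-- If a random comparable pair witnesses non-monotonicity of every function that is `ε`-far from
monotone with probability at least `β`, then `t ≥ 2 / β` independent pairs give a tester. -/
theorem exists_tester_of_pairs {Ω : Type} [Fintype Ω] [Nonempty Ω] (lo hi : Ω → Cube n)
    (hle : ∀ ω, lo ω ≤ hi ω) {ε β : ℝ}
    (hβ : ∀ f : Cube n → Bool, FarFromMonotone ε f →
      β ≤ 𝔼 ω, ind (f (lo ω) && !f (hi ω))) (t : ℕ) (ht : 2 ≤ β * t) :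
    ∃ T : RandNonadaptive n (2 * t), IsOneSidedMonotonicityTester ε T := by
  refine ⟨(PMF.uniformOfFintype (Fin t → Ω)).map fun ω =>
    pairTester (fun j => lo (ω j)) (fun j => hi (ω j)), fun f hf => ?_, fun f hf => ?_⟩
  · unfold RandNonadaptive.prob
    rw [PMF.map_comp]
    have : (fun A : DetNonadaptive n (2 * t) => A.output f) ∘ (fun ω : Fin t → Ω =>
        pairTester (fun j => lo (ω j)) (fun j => hi (ω j))) = Function.const _ true := by
      funext ω
      simp only [Function.comp_apply, pairTester_output, Function.const_apply, decide_eq_true_eq]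
      rintro j ⟨h1, h2⟩
      have := hf (hle (ω j))
      rw [h1, h2] at this
      exact absurd this (by decide)
    rw [this, PMF.map_const]
    simp
  · set v : Ω → ℝ := fun ω => ind (f (lo ω) && !f (hi ω)) with hv
    set out : (Fin t → Ω) → Bool := fun ω =>
      decide (∀ j, ¬(f (lo (ω j)) = true ∧ f (hi (ω j)) = false)) with hout
    have hacc : 𝔼 ω : Fin t → Ω, ind (out ω) = (1 - 𝔼 ω, v ω) ^ t := by
      have e1 : 1 - 𝔼 ω, v ω = 𝔼 ω, (1 - v ω) := by
        rw [expect_sub_distrib, Fintype.expect_const]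
      rw [e1, Finset.expect_pow]
      rw [Fintype.piFinset_univ]
      refine expect_congr rfl fun ω _ => ?_
      by_cases h : ∀ j, ¬(f (lo (ω j)) = true ∧ f (hi (ω j)) = false)
      · have : out ω = true := by simp only [hout]; exact decide_eq_true h
        rw [this, prod_eq_one]
        · simp [ind]
        · intro j _
          have := h j
          revert this
          simp only [hv]
          cases f (lo (ω j)) <;> cases f (hi (ω j)) <;> simp [ind]
      · have : out ω = false := by simp only [hout]; exact decide_eq_false h
        push Not at h
        obtain ⟨j, h1, h2⟩ := h
        rw [this, prod_eq_zero (mem_univ j)]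
        · simp [ind]
        · simp [hv, ind, h1, h2]
    have hsmall : 𝔼 ω : Fin t → Ω, ind (out ω) ≤ 1 / 3 := by
      have hv1 : 𝔼 ω, v ω ≤ 1 := expect_le univ_nonempty fun _ _ => ind_le_one _
      have hb := hβ f hf
      rw [hacc]
      calc (1 - 𝔼 ω, v ω) ^ t ≤ Real.exp (-β) ^ t := by
            refine pow_le_pow_left₀ (by linarith) ?_ t
            linarith [Real.add_one_le_exp (-β)]
        _ = Real.exp (-(β * t)) := by rw [← Real.exp_nat_mul]; ring_nf
        _ ≤ Real.exp (-2) := Real.exp_le_exp.2 (by linarith)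
        _ ≤ 1 / 3 := by
            rw [Real.exp_neg, ← one_div]
            apply one_div_le_one_div_of_le (by norm_num)
            linarith [Real.add_one_le_exp 2]
    have hcard : (0 : ℝ) < Fintype.card (Fin t → Ω) := by exact_mod_cast Fintype.card_pos
    have hrej : (2 : ℝ) / 3 ≤ ((univ.filter fun ω => out ω = false).card : ℝ) /
        Fintype.card (Fin t → Ω) := by
      have e1 : 𝔼 ω : Fin t → Ω, (1 - ind (out ω)) =
          ((univ.filter fun ω => out ω = false).card : ℝ) / Fintype.card (Fin t → Ω) := by
        rw [Fintype.expect_eq_sum_div_card, ← sum_boole]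
        congr 1
        refine sum_congr rfl fun ω _ => ?_
        cases out ω <;> simp [ind]
      rw [← e1, expect_sub_distrib, Fintype.expect_const]
      linarith
    have hprob : RandNonadaptive.prob ((PMF.uniformOfFintype (Fin t → Ω)).map fun ω =>
        pairTester (fun j => lo (ω j)) (fun j => hi (ω j))) f false =
        ((univ.filter fun ω => out ω = false).card : ℝ≥0∞) / Fintype.card (Fin t → Ω) := by
      unfold RandNonadaptive.prob
      rw [PMF.map_comp, PMF.map_apply, tsum_fintype]
      simp only [Function.comp_apply, pairTester_output, PMF.uniformOfFintype_apply]
      rw [← sum_filter, sum_const, nsmul_eq_mul, div_eq_mul_inv]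
      congr 3
      ext ω
      simp only [mem_filter, mem_univ, true_and, hout]
      exact eq_comm
    rw [hprob]
    have e2 : ((univ.filter fun ω => out ω = false).card : ℝ≥0∞) / Fintype.card (Fin t → Ω) =
        ENNReal.ofReal (((univ.filter fun ω => out ω = false).card : ℝ) /
          Fintype.card (Fin t → Ω)) := by
      rw [ENNReal.ofReal_div_of_pos hcard, ENNReal.ofReal_natCast, ENNReal.ofReal_natCast]
    have e3 : (2 / 3 : ℝ≥0∞) = ENNReal.ofReal (2 / 3) := by
      rw [ENNReal.ofReal_div_of_pos (by norm_num)]; norm_num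
    rw [e2, e3]
    exact ENNReal.ofReal_le_ofReal hrej

/-- Without functions that are far from monotone there is nothing to test. -/
lemma exists_tester_zero {ε : ℝ} (h : ∀ f : Cube n → Bool, ¬FarFromMonotone ε f) :
    ∃ T : RandNonadaptive n 0, IsOneSidedMonotonicityTester ε T := by
  refine ⟨PMF.pure ⟨fun q => q.elim0, fun _ => true⟩, fun f _ => ?_, fun f hf => absurd hf (h f)⟩
  simp [RandNonadaptive.prob, PMF.pure_map, DetNonadaptive.output]

/-- A random pair of points, the ends of a random edge with probability one half and the ends of a
random walk with probability one half, witnesses non-monotonicity as often as half the better of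
the two. -/
theorem exists_tester_of_edge_or_walk (hn : 0 < n) (k : ℕ) {ε α : ℝ}
    (h : ∀ f : Cube n → Bool, FarFromMonotone ε f → α ≤ (∑ i, violation i f) / n ∨
      α ≤ 𝔼 x, 𝔼 s : Fin n → Fin (k + 1), ind (f (lower x s) && !f (upper x s)))
    (t : ℕ) (ht : 4 ≤ α * t) :
    ∃ T : RandNonadaptive n (2 * t), IsOneSidedMonotonicityTester ε T := by
  have : Nonempty (Fin n) := ⟨⟨0, hn⟩⟩
  let Ω := Bool × (Cube n × Fin n) × (Cube n × (Fin n → Fin (k + 1)))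
  refine exists_tester_of_pairs (Ω := Ω) (β := α / 2)
    (fun ω => if ω.1 then Function.update ω.2.1.1 ω.2.1.2 false else lower ω.2.2.1 ω.2.2.2)
    (fun ω => if ω.1 then Function.update ω.2.1.1 ω.2.1.2 true else upper ω.2.2.1 ω.2.2.2)
    (fun ω => ?_) (fun f hf => ?_) t (by linarith)
  · split_ifs
    · intro j
      by_cases hj : j = ω.2.1.2
      · rw [hj]; simp
      · simp [hj]
    · intro j
      unfold lower upper
      by_cases hs : ω.2.2.2 j = 0
      · simp [hs]
      · simp [hs]
  · set a := 𝔼 x, 𝔼 s : Fin n → Fin (k + 1), ind (f (lower x s) && !f (upper x s)) with ha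
    have e1 : 𝔼 ω : Cube n × Fin n,
        ind (f (Function.update ω.1 ω.2 false) && !f (Function.update ω.1 ω.2 true)) =
        (∑ i, violation i f) / n := by
      rw [expect_prod fun (x : Cube n) i =>
        ind (f (Function.update x i false) && !f (Function.update x i true)), expect_comm,
        Fintype.expect_eq_sum_div_card, Fintype.card_fin]
      rfl
    have e2 : 𝔼 ω : Cube n × (Fin n → Fin (k + 1)),
        ind (f (lower ω.1 ω.2) && !f (upper ω.1 ω.2)) = a :=
      expect_prod fun (x : Cube n) (s : Fin n → Fin (k + 1)) =>
        ind (f (lower x s) && !f (upper x s))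
    have ha0 : 0 ≤ a := expect_nonneg fun _ _ => expect_nonneg fun _ _ => ind_nonneg _
    have hv0 : 0 ≤ (∑ i, violation i f) / n :=
      div_nonneg (sum_nonneg fun i _ => violation_nonneg i f) (Nat.cast_nonneg _)
    have e3 : 𝔼 ω : Ω, ind (f (if ω.1 then Function.update ω.2.1.1 ω.2.1.2 false
          else lower ω.2.2.1 ω.2.2.2) && !f (if ω.1 then Function.update ω.2.1.1 ω.2.1.2 true
          else upper ω.2.2.1 ω.2.2.2)) = ((∑ i, violation i f) / n + a) / 2 := by
      rw [expect_prod fun (b : Bool) (ω : (Cube n × Fin n) × (Cube n × (Fin n → Fin (k + 1)))) =>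
        ind (f (if b then Function.update ω.1.1 ω.1.2 false
          else lower ω.2.1 ω.2.2) && !f (if b then Function.update ω.1.1 ω.1.2 true
          else upper ω.2.1 ω.2.2)), Fintype.expect_eq_sum_div_card]
      simp only [Fintype.sum_bool, Fintype.card_bool, if_true, Bool.false_eq_true, if_false]
      rw [expect_prod fun (p : Cube n × Fin n) (_ : Cube n × (Fin n → Fin (k + 1))) =>
          ind (f (Function.update p.1 p.2 false) && !f (Function.update p.1 p.2 true)),
        expect_prod fun (_ : Cube n × Fin n) (p : Cube n × (Fin n → Fin (k + 1))) =>
          ind (f (lower p.1 p.2) && !f (upper p.1 p.2))]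
      simp only [Fintype.expect_const]
      rw [e1, e2]
      norm_num
    rw [e3]
    rcases h f hf with h | h <;> linarith

end Tester

/-! ### Choice of parameters -/

section Parameters

variable {n : ℕ}

lemma one_le_log_add_two (hn : 0 < n) : 1 ≤ Real.log (n + 2) := by
  have h3 : (3 : ℝ) ≤ n + 2 := by
    have : (1 : ℝ) ≤ n := by exact_mod_cast hn
    linarith
  rw [Real.le_log_iff_exp_le (by linarith)]
  linarith [Real.exp_one_lt_d9]

lemma log_le_log_add_two (hn : 0 < n) : Real.log n ≤ Real.log (n + 2) :=
  Real.log_le_log (by exact_mod_cast hn) (by linarith)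

lemma harmonic_le_two_mul_log (hn : 0 < n) : (harmonic n : ℝ) ≤ 2 * Real.log (n + 2) := by
  linarith [harmonic_le_one_add_log n, log_le_log_add_two hn, one_le_log_add_two hn]

/-- A number of scales after which a random set of density `2⁻ᵐ` is empty with probability at least
`1 - ε / 2`. -/
lemma exists_pow_two_ge (hn : 0 < n) {ε : ℝ} (h0 : 0 < ε) (h1 : ε ≤ 1) :
    ∃ m : ℕ, n * (1 / 2 : ℝ) ^ m ≤ ε / 2 ∧ (m : ℝ) ≤ 6 * Real.log (n + 2) / ε := by
  have hn' : (1 : ℝ) ≤ n := by exact_mod_cast hn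
  have hL := one_le_log_add_two hn
  set X : ℝ := 2 * n / ε with hX
  have hX1 : 1 ≤ X := by rw [hX, le_div_iff₀ h0]; linarith
  have hl2 : (0.69 : ℝ) < Real.log 2 := by linarith [Real.log_two_gt_d9]
  have hlX : 0 ≤ Real.log X := Real.log_nonneg hX1
  refine ⟨⌈Real.log X / Real.log 2⌉₊, ?_, ?_⟩
  · set m := ⌈Real.log X / Real.log 2⌉₊
    have hm : Real.log X / Real.log 2 ≤ m := Nat.le_ceil _
    rw [div_le_iff₀ (by linarith)] at hm
    have h2 : X ≤ 2 ^ m := by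
      rw [← Real.log_le_log_iff (by linarith) (by positivity), Real.log_pow]
      exact hm
    rw [hX, div_le_iff₀ h0] at h2
    rw [one_div, inv_pow, ← div_eq_mul_inv, div_le_iff₀ (by positivity)]
    linarith
  · have hlt := Nat.ceil_lt_add_one (div_nonneg hlX (by linarith : 0 ≤ Real.log 2))
    have e : Real.log X = Real.log 2 + Real.log n + Real.log (1 / ε) := by
      rw [hX, ← Real.log_mul (by norm_num) (by linarith), ← Real.log_mul (by positivity)
        (by positivity)]
      congr 1; ring
    have h3 : Real.log (1 / ε) ≤ 1 / ε - 1 := Real.log_le_sub_one_of_pos (by positivity)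
    have h4 := log_le_log_add_two hn
    set L := Real.log (n + 2)
    have hi : 1 ≤ 1 / ε := by rw [le_div_iff₀ h0]; linarith
    have h5 : Real.log X ≤ 2 * (L / ε) + Real.log 2 - 1 := by
      have h6 : L ≤ L / ε := by rw [le_div_iff₀ h0]; nlinarith
      have h7 : 1 / ε ≤ L / ε := by gcongr
      linarith
    have h8 : 1 ≤ L / ε := by rw [le_div_iff₀ h0]; linarith
    have h9 : Real.log X / Real.log 2 ≤ 2 * (L / ε) / 0.69 := by
      have : Real.log X ≤ 2 * (L / ε) := by linarith [Real.log_two_lt_d9]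
      gcongr
    rw [mul_div_assoc]
    have : 2 * (L / ε) / 0.69 ≤ 3 * (L / ε) := by
      rw [div_le_iff₀ (by norm_num)]; linarith
    linarith

/-- A function far from monotone has many decreasing edges or a large matching of them. The weight
`l` balances the two alternatives. -/
theorem violation_or_matching_large (hn : 0 < n) {ε : ℝ} (h0 : 0 < ε) (h1 : ε ≤ 1)
    {f : Cube n → Bool} (hf : FarFromMonotone ε f) {l : ℝ} (hl : 0 < l) :
    ∃ M, IsDecreasingMatching f M ∧
      (ε ^ 2 / (96 * Real.log (n + 2) ^ 2) ≤ l * ∑ i, violation i f ∨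
        ε ^ 2 / (96 * Real.log (n + 2) ^ 2) ≤ 2 * l⁻¹ * ((M.card : ℝ) / 2 ^ n)) := by
  obtain ⟨M, fm, fp, hM, hm, hp, hdom, hdisc⟩ := exists_matching_edgeDominated f
  refine ⟨M, hM, ?_⟩
  obtain ⟨m, hm1, hm2⟩ := exists_pow_two_ge hn h0 h1
  have hiso := le_of_farFromMonotone hf hm hp hdom hl m
  have hL := one_le_log_add_two hn
  have hH := harmonic_le_two_mul_log hn
  set L := Real.log (n + 2)
  set I := ∑ i, violation i f
  have hI : 0 ≤ I := sum_nonneg fun i _ => violation_nonneg i f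
  set μ := (M.card : ℝ) / 2 ^ n
  have hμ : 0 ≤ μ := by positivity
  have hli : 0 ≤ l⁻¹ := inv_nonneg.2 hl.le
  set Z := l * I + 2 * l⁻¹ * μ with hZ
  have hZ0 : 0 ≤ Z := by positivity
  have h2 : (m : ℝ) * (2 * (harmonic n : ℝ) * (l * I + l⁻¹ * discrepancy fm fp)) ≤
      6 * L / ε * (2 * (2 * L) * Z) := by
    have hle : l * I + l⁻¹ * discrepancy fm fp ≤ Z := by
      have := mul_le_mul_of_nonneg_left hdisc hli
      rw [hZ]; linarith
    have hd0 : 0 ≤ discrepancy fm fp := expect_nonneg fun _ _ => ind_nonneg _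
    have hnn : 0 ≤ l * I + l⁻¹ * discrepancy fm fp := by positivity
    have hH0 : (0 : ℝ) ≤ harmonic n := by
      exact_mod_cast sum_nonneg fun i _ => by positivity
    gcongr
  have h3 : ε ^ 2 / (48 * L ^ 2) ≤ Z := by
    have h4 : ε / 2 ≤ 6 * L / ε * (2 * (2 * L) * Z) := by linarith
    have e : 6 * L / ε * (2 * (2 * L) * Z) = 24 * L ^ 2 * Z / ε := by ring
    rw [e, le_div_iff₀ h0] at h4
    rw [div_le_iff₀ (by positivity)]
    nlinarith
  have e : ε ^ 2 / (48 * L ^ 2) = 2 * (ε ^ 2 / (96 * L ^ 2)) := by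
    field_simp; norm_num
  rw [e] at h3
  by_contra! hcon
  linarith [hcon.1, hcon.2]

lemma natLog_add_two_le (hn : 0 < n) : ((Nat.log 2 n + 1 : ℕ) : ℝ) + 1 ≤ 4 * Real.log (n + 2) := by
  have hL := one_le_log_add_two hn
  have h1 : (2 : ℝ) ^ Nat.log 2 n ≤ n := by exact_mod_cast Nat.pow_log_le_self 2 hn.ne'
  have h2 := Real.log_le_log (by positivity) h1
  rw [Real.log_pow] at h2
  have h3 := log_le_log_add_two hn
  have h4 : (0.69 : ℝ) < Real.log 2 := by linarith [Real.log_two_gt_d9]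
  have h5 : (0 : ℝ) ≤ Nat.log 2 n := Nat.cast_nonneg _
  push_cast
  nlinarith

/-- A single random edge or a single random walk of suitable length detects a function far from
monotone with probability of order `ε⁴ n^(-5/6)`, up to logarithmic factors. Here `N = n^(1/6)`. If
there are fewer than `κ * N` decreasing edges per point, then a matching of density `σ`, of order
`κ / N`, exists, and a walk that moves each coordinate with probability `p` of order `σ / √n`, up to
a logarithm, rarely meets an edge along which `f` changes other than the one in the matching. -/
theorem exists_walk_length (hn : 0 < n) {ε : ℝ} (h0 : 0 < ε) (h1 : ε ≤ 1) {N : ℝ} (hN0 : 0 < N)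
    (hN : N ^ 6 = n) :
    ∃ k : ℕ, ∀ f : Cube n → Bool, FarFromMonotone ε f →
      (ε ^ 2 / (96 * Real.log (n + 2) ^ 2)) ^ 2 / (2560 * N ^ 5 * Real.log (n + 2)) ≤
        (∑ i, violation i f) / n ∨
      (ε ^ 2 / (96 * Real.log (n + 2) ^ 2)) ^ 2 / (2560 * N ^ 5 * Real.log (n + 2)) ≤
        𝔼 x, 𝔼 s : Fin n → Fin (k + 1), ind (f (lower x s) && !f (upper x s)) := by
  have hn' : (1 : ℝ) ≤ n := by exact_mod_cast hn
  have hN1 : 1 ≤ N := by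
    by_contra hlt
    have := pow_lt_one₀ hN0.le (not_le.1 hlt) (n := 6) (by norm_num)
    linarith
  have hL := one_le_log_add_two hn
  have hr4 := natLog_add_two_le hn
  have hsqrt : √(n : ℝ) = N ^ 3 := by
    rw [← hN, show N ^ 6 = (N ^ 3) ^ 2 by ring, Real.sqrt_sq (by positivity)]
  set r := Nat.log 2 n + 1 with hr
  have hnr : n ≤ 2 ^ r := (Nat.lt_pow_succ_log_self (by norm_num) n).le
  have hr1 : (1 : ℝ) ≤ (r : ℝ) + 1 := by linarith [(Nat.cast_nonneg r : (0 : ℝ) ≤ r)]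
  set L := Real.log (n + 2)
  set κ := ε ^ 2 / (96 * L ^ 2) with hκ
  have hκ0 : 0 < κ := by positivity
  have hκ1 : κ ≤ 1 := by
    rw [hκ, div_le_one (by positivity)]
    nlinarith
  set σ := κ / (2 * N) with hσ
  have hσ0 : 0 < σ := by positivity
  have hσ1 : σ ≤ 1 := by
    rw [hσ, div_le_one (by positivity)]
    linarith
  set X := 40 * N ^ 3 * ((r : ℝ) + 1) / σ with hX
  have hN31 : 1 ≤ N ^ 3 := one_le_pow₀ hN1
  have hX2 : 2 ≤ X := by
    rw [hX, le_div_iff₀ hσ0]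
    nlinarith
  have hX0 : 0 < X := by linarith
  set k := ⌈X⌉₊ with hk
  have hk1 : X ≤ (k : ℝ) + 1 := (Nat.le_ceil X).trans (by linarith)
  have hk2 : (k : ℝ) + 1 ≤ 2 * X := by
    have := Nat.ceil_lt_add_one hX0.le
    linarith
  set p : ℝ := 1 / (k + 1) with hp
  have hp0 : 0 < p := by positivity
  have hpX : p ≤ 1 / X := one_div_le_one_div_of_le hX0 hk1
  have hpX2 : 1 / (2 * X) ≤ p := one_div_le_one_div_of_le (by positivity) hk2
  have hpσ : p * (40 * N ^ 3 * ((r : ℝ) + 1)) ≤ σ := by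
    have e : 1 / X * (40 * N ^ 3 * ((r : ℝ) + 1)) = σ := by
      rw [hX]; field_simp
    rw [← e]
    gcongr
  -- The claimed probability is below what the walk achieves in the presence of a matching of density
  -- `σ`, and below what a random edge achieves in the presence of `κ * N` decreasing edges per point.
  have hα1 : κ ^ 2 / (2560 * N ^ 5 * L) ≤ p * σ / 2 := by
    have e : 1 / (2 * X) * σ / 2 = κ ^ 2 / (640 * N ^ 5 * ((r : ℝ) + 1)) := by
      rw [hX, hσ]; field_simp; norm_num
    calc κ ^ 2 / (2560 * N ^ 5 * L) = κ ^ 2 / (640 * N ^ 5 * (4 * L)) := by ring_nf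
      _ ≤ κ ^ 2 / (640 * N ^ 5 * ((r : ℝ) + 1)) := by gcongr
      _ = 1 / (2 * X) * σ / 2 := e.symm
      _ ≤ p * σ / 2 := by gcongr
  have hα2 : κ ^ 2 / (2560 * N ^ 5 * L) ≤ κ / N ^ 5 := by
    have hN5 : 0 < N ^ 5 := by positivity
    rw [div_le_div_iff₀ (by positivity) hN5]
    have : κ ^ 2 ≤ κ * (2560 * L) := by nlinarith
    nlinarith
  refine ⟨k, fun f hf => ?_⟩
  obtain ⟨M, hM, hcase⟩ := violation_or_matching_large hn h0 h1 hf (inv_pos.2 hN0)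
  set I := ∑ i, violation i f with hI
  by_cases hIbig : N ^ 3 ≤ I
  · left
    refine hα2.trans ?_
    rw [← hN, div_le_div_iff₀ (by positivity) (by positivity)]
    have h3 : κ * N ^ 6 ≤ N ^ 3 * N ^ 5 := by
      have : N ^ 3 * N ^ 5 = N ^ 2 * N ^ 6 := by ring
      rw [this]
      have h4 : 1 ≤ N ^ 2 := one_le_pow₀ hN1
      gcongr
      linarith
    exact h3.trans (by gcongr)
  rcases hcase with hcase | hcase
  · left
    refine hα2.trans ?_
    rw [← hN, div_le_div_iff₀ (by positivity) (by positivity)]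
    have h2 : κ * N ≤ I := by
      rwa [← div_eq_inv_mul, le_div_iff₀ hN0] at hcase
    have : κ * N ^ 6 = κ * N * N ^ 5 := by ring
    rw [this]
    gcongr
  · right
    set μ := (M.card : ℝ) / 2 ^ n with hμ
    have hσμ : σ ≤ μ := by
      rw [inv_inv] at hcase
      rw [hσ, div_le_iff₀ (by positivity)]
      linarith
    have hshort : (n : ℝ) * (1 / ((k : ℝ) + 1)) ^ 2 * ((r : ℝ) + 1) ^ 2 ≤ 1 := by
      rw [← hp, ← hN]
      have h2 : p * (N ^ 3 * ((r : ℝ) + 1)) ≤ 1 := by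
        have : 0 ≤ p * (N ^ 3 * ((r : ℝ) + 1)) := by positivity
        nlinarith
      have e : N ^ 6 * p ^ 2 * ((r : ℝ) + 1) ^ 2 = (p * (N ^ 3 * ((r : ℝ) + 1))) ^ 2 := by ring
      rw [e]
      exact pow_le_one₀ (by positivity) h2
    refine le_trans ?_ (le_expect_lower_upper hM hshort hnr)
    rw [← hp]
    have hinf := sum_influence_le hn f
    rw [hsqrt, ← hI] at hinf
    push Not at hIbig
    have h5 : 2 * (p * (2 * ∑ i, influence i f + 2)) ≤ σ / 2 := by
      have h6 : 2 * ∑ i, influence i f + 2 ≤ 10 * N ^ 3 := by linarith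
      have h7 : p * (2 * ∑ i, influence i f + 2) ≤ p * (10 * N ^ 3) := by gcongr
      have h8 : p * (40 * N ^ 3) ≤ p * (40 * N ^ 3 * ((r : ℝ) + 1)) := by
        have : 40 * N ^ 3 ≤ 40 * N ^ 3 * ((r : ℝ) + 1) := le_mul_of_one_le_right (by positivity) hr1
        gcongr
      linarith
    refine hα1.trans ?_
    have : σ / 2 ≤ μ - 2 * (p * (2 * ∑ i, influence i f + 2)) := by linarith
    calc p * σ / 2 = p * (σ / 2) := by ring
      _ ≤ _ := by gcongr

/-- For fixed dimension and distance parameter the tester exists with the stated number of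
queries. -/
theorem exists_tester (n : ℕ) (ε : ℝ) : ∃ (q : ℕ) (T : RandNonadaptive n q), 0 < ε →
    IsOneSidedMonotonicityTester ε T ∧
      (q : ℝ) ≤ 16 * 2560 * 96 ^ 2 * ((n : ℝ) ^ (5 / 6 : ℝ) * ε ^ (-4 : ℤ)) *
        Real.log (n + 2) ^ 5 := by
  by_cases h0 : 0 < ε
  swap
  · exact ⟨0, PMF.pure ⟨fun q => q.elim0, fun _ => true⟩, fun h => absurd h h0⟩
  have hrhs : 0 ≤ 16 * 2560 * 96 ^ 2 * ((n : ℝ) ^ (5 / 6 : ℝ) * ε ^ (-4 : ℤ)) *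
      Real.log (n + 2) ^ 5 := by
    have : 0 ≤ Real.log (n + 2) :=
      Real.log_nonneg (by linarith [(Nat.cast_nonneg n : (0 : ℝ) ≤ n)])
    positivity
  by_cases hnone : ∀ f : Cube n → Bool, ¬FarFromMonotone ε f
  · obtain ⟨T, hT⟩ := exists_tester_zero hnone
    exact ⟨0, T, fun _ => ⟨hT, by simpa using hrhs⟩⟩
  push Not at hnone
  obtain ⟨f, hf⟩ := hnone
  have hn : 0 < n := by
    rcases Nat.eq_zero_or_pos n with rfl | h
    · refine absurd ⟨f, fun x y _ => (congrArg f (Subsingleton.elim x y)).le, ?_⟩ hf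
      simp [dist, h0.le]
    · exact h
  have h1 : ε ≤ 1 := by
    by_contra hlt
    refine hf ⟨fun _ => true, fun _ _ _ => le_rfl, ?_⟩
    rw [dist_eq_discrepancy]
    exact (discrepancy_le_one _ _).trans (not_le.1 hlt).le
  have hn' : (0 : ℝ) < n := by exact_mod_cast hn
  set N : ℝ := (n : ℝ) ^ (1 / 6 : ℝ) with hNdef
  have hN0 : 0 < N := Real.rpow_pos_of_pos hn' _
  have hN : N ^ 6 = n := by
    rw [hNdef, ← Real.rpow_natCast, ← Real.rpow_mul hn'.le]; norm_num
  have hN5 : (n : ℝ) ^ (5 / 6 : ℝ) = N ^ 5 := by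
    rw [hNdef, ← Real.rpow_natCast, ← Real.rpow_mul hn'.le]; norm_num
  have hL := one_le_log_add_two hn
  obtain ⟨k, hk⟩ := exists_walk_length hn h0 h1 hN0 hN
  set L := Real.log (n + 2)
  set α := (ε ^ 2 / (96 * L ^ 2)) ^ 2 / (2560 * N ^ 5 * L) with hα
  have hα0 : 0 < α := by positivity
  have hαinv : 4 / α = 4 * 2560 * 96 ^ 2 * (N ^ 5 * ε ^ (-4 : ℤ)) * L ^ 5 := by
    rw [hα, zpow_neg, show (4 : ℤ) = ((4 : ℕ) : ℤ) from rfl, zpow_natCast]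
    field_simp
  have hα1 : 1 ≤ 4 / α := by
    have hε4 : 1 ≤ ε ^ (-4 : ℤ) := by
      rw [zpow_neg, show (4 : ℤ) = ((4 : ℕ) : ℤ) from rfl, zpow_natCast]
      exact (one_le_inv₀ (by positivity)).2 (pow_le_one₀ h0.le h1)
    have hN51 : 1 ≤ N ^ 5 := by
      rw [← hN5]
      exact Real.one_le_rpow (by exact_mod_cast hn) (by norm_num)
    have hL5 : 1 ≤ L ^ 5 := one_le_pow₀ hL
    rw [hαinv]
    have : 1 ≤ N ^ 5 * ε ^ (-4 : ℤ) := one_le_mul_of_one_le_of_one_le hN51 hε4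
    nlinarith
  obtain ⟨T, hT⟩ := exists_tester_of_edge_or_walk hn k hk ⌈4 / α⌉₊ (by
    have := Nat.le_ceil (4 / α)
    rw [div_le_iff₀ hα0] at this
    linarith)
  refine ⟨_, T, fun _ => ⟨hT, ?_⟩⟩
  have hc := Nat.ceil_lt_add_one (by positivity : 0 ≤ 4 / α)
  rw [hN5]
  push_cast
  have e : 16 * 2560 * 96 ^ 2 * (N ^ 5 * ε ^ (-4 : ℤ)) * L ^ 5 = 4 * (4 / α) := by
    rw [hαinv]; ring
  rw [e]
  linarith

end Parameters

end MonotonicityTesting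


theorem mainTheorem3 :
    ∃ (C : ℝ) (c : ℕ) (q : ℕ → ℝ → ℕ)
      (T : ∀ (n : ℕ) (ε : ℝ), MonotonicityTesting.RandNonadaptive n (q n ε)),
      ∀ (n : ℕ) (ε : ℝ), 0 < ε →
        MonotonicityTesting.IsOneSidedMonotonicityTester ε (T n ε) ∧
          (q n ε : ℝ) ≤ C * ((n : ℝ) ^ (5 / 6 : ℝ) * ε ^ (-4 : ℤ)) * Real.log (n + 2) ^ c := by
  choose q T h using MonotonicityTesting.exists_tester
  exact ⟨_, 5, q, T, h⟩
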